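/- Let $\mathrm{SWAP}_5$ be the problem of deciding, for a finite sequence $[a_1\leftrightarrow b_1]\dots[a_m\leftrightarrow b_m]$ of swaps with $a_i\ne b_i$ in a five-element set (20 possible instructions), whether the composition of the transpositions $(a_i\,b_i)$ is the identity permutation. Then: (a) $\mathrm{SWAP}_5$ is $\mathsf{NC}^1$-complete under $\mathsf{AC}^0$-reductions. That is, it is decided by circuit families of fan-in two, polynomial size and depth $O(\log n)$, and every language over a finite alphabet that is decided by such a family has a many-one reduction to $\mathrm{SWAP}_5$, with output length polynomial and determined by the input length, computed by circuits of unbounded fan-in, polynomial size and constant depth. (Circuit families are non-uniform.) (b) $\mathrm{SWAP}_5$ is solved by one-layer PaTH transformers with two attention heads and $O(\log n)$ precision. That is, there are constants $D,d,k$ and a function $p(n)=O(\log n)$ such that for every $n$ there is a one-layer PaTH transformer with two heads, model dimension $D$, head dimension $d$ and feed-forward width $k$, all of whose parameters are floating-point numbers of precision $p(n)$, with the following property: for every rounding to precision $p(n)$ and every sequence of $m\le n$ swaps, on the input $\#\,[a_1\leftrightarrow b_1]\dots[a_m\leftrightarrow b_m]$, where $\#$ is a start token, the output computed in the last position is $1$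 if the swaps compose to the identity permutation, and $-1$ otherwise. Here a floating-point number of precision $p$ is a real number $\mu 2^{e}$ with integers $|\mu|<2^p$, $|e|<2^p$, and a rounding to precision $p$ is a monotone map from $\mathbb R$ to these numbers that fixes each of them (for instance rounding to nearest, or truncation). A one-layer PaTH transformer embeds the token in position $t\in\{0,\dots,m\}$ as a vector $\mathbf x_t\in\mathbb R^D$. Each head has matrices $\mathbf W_q,\mathbf W_k,\mathbf W_v,\mathbf W_w\in\mathbb R^{d\times D}$, a vector $\mathbf u\in\mathbb R^D$ and a number $b$, and computes $\mathbf q_t=\mathbf W_q\mathbf x_t$, $\mathbf k_t=\mathbf W_k\mathbf x_t$, $\mathbf v_t=\mathbf W_v\mathbf x_t$, $\mathbf w_t=\mathbf W_w\mathbf x_t/\lVert\mathbf W_w\mathbf x_t\rVert_2$ (or $\mathbf 0$ if $\mathbf W_w\mathbf x_t=\mathbf 0$), $\beta_t=2\operatorname{sigmoid}(\mathbf u^\top\mathbf x_t+b)$, $\mathbf H_t=\mathbf I-\beta_t\mathbf w_t\mathbf w_t^\top$, and its output in position $i$ is $$\mathbf o_i=\frac1{Z_i}\sum_{j=0}^{i}\exp\bigl(\mathbf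 k_j^\top\mathbf H_{j+1}\mathbf H_{j+2}\cdots\mathbf H_i\,\mathbf q_i\bigr)\,\mathbf v_j,\qquad Z_i=\sum_{j=0}^{i}\exp\bigl(\mathbf k_j^\top\mathbf H_{j+1}\mathbf H_{j+2}\cdots\mathbf H_i\,\mathbf q_i\bigr).$$ The concatenated head outputs are multiplied by an output matrix $\mathbf W_o\in\mathbb R^{D\times 2d}$, giving $\mathbf y\in\mathbb R^D$, and a feed-forward layer with $k$ hidden units gives the output $\mathbf c^\top\operatorname{sign}(\mathbf W_1\mathbf y+\mathbf b_1)+b_2$. In the computation with a given rounding, the rounding is applied, entry by entry, to each of the following: the vectors $\mathbf q_t,\mathbf k_t,\mathbf v_t$, $\mathbf W_w\mathbf x_t$, $\mathbf w_t$, the number $\mathbf u^\top\mathbf x_t+b$, $\beta_t$, the matrix $\mathbf H_t$, each successive row vector $\mathbf k_j^\top\mathbf H_{j+1}\cdots\mathbf H_s$ (computed from the rounded one before it), the logit, its exponential, the sum $Z_i$, each normalized attention weight, $\mathbf o_i$, $\mathbf y$, the argument of $\operatorname{sign}$, and the output. -/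

import Mathlib

namespace PaTH

/-! ## Boolean circuits, `NC¹` and `AC⁰`-reductions -/

/-- The operation performed by a gate of a circuit with input literals `ι` and gates `G`.  The
conjunction and disjunction gates have arbitrary fan-in; the empty ones are the constants. -/
inductive GateOp (ι G : Type) : Type
  | input (i : ι) : GateOp ι G
  | not (g : G) : GateOp ι G
  | and (S : Finset G) : GateOp ι G
  | or (S : Finset G) : GateOp ι G

/-- The gates wired into a gate. -/
def GateOp.children {ι G : Type} : GateOp ι G → Finset G
  | .input _ => ∅
  | .not g => {g}
  | .and S => S
  | .or S => S

/-- A Boolean circuit: a finite directed acyclic graph of gates with a designated output gate.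
The function `level` strictly increases along wires; it certifies acyclicity, and every path that
ends in a gate `g` has at most `level g` wires. -/
structure Circuit (ι : Type) : Type 1 where
  Gate : Type
  fintypeGate : Fintype Gate
  op : Gate → GateOp ι Gate
  level : Gate → ℕ
  level_lt : ∀ g, ∀ g' ∈ (op g).children, level g' < level g
  out : Gate

namespace Circuit

variable {ι : Type}

/-- The number of gates. -/
def size (C : Circuit ι) : ℕ := @Fintype.card C.Gate C.fintypeGate

/-- The depth (the level of the output gate). -/
def depth (C : Circuit ι) : ℕ := C.level C.out

/-- Every gate has at most two inputs. -/
def FanInTwo (C : Circuit ι) : Prop := ∀ g, (C.op g).children.card ≤ 2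

/-- The truth value of a gate under an assignment of truth values to the input literals. -/
def eval (C : Circuit ι) (x : ι → Prop) (g : C.Gate) : Prop :=
  match h : C.op g with
  | .input i => x i
  | .not g' => ¬ C.eval x g'
  | .and S => ∀ g' : S, C.eval x g'.1
  | .or S => ∃ g' : S, C.eval x g'.1
termination_by C.level g
decreasing_by
  · exact C.level_lt g g' (by simp [h, GateOp.children])
  · exact C.level_lt g g'.1 (by simp [h, GateOp.children])
  · exact C.level_lt g g'.1 (by simp [h, GateOp.children])

theorem eval_input (C : Circuit ι) (x : ι → Prop) (g : C.Gate) (i : ι)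
    (h : C.op g = .input i) : C.eval x g ↔ x i := by
  rw [eval]; split <;> simp_all

theorem eval_not (C : Circuit ι) (x : ι → Prop) (g g' : C.Gate)
    (h : C.op g = .not g') : C.eval x g ↔ ¬ C.eval x g' := by
  rw [eval]; split <;> simp_all

theorem eval_and (C : Circuit ι) (x : ι → Prop) (g : C.Gate) (S : Finset C.Gate)
    (h : C.op g = .and S) : C.eval x g ↔ ∀ g' ∈ S, C.eval x g' := by
  rw [eval]; split <;> simp_all

theorem eval_or (C : Circuit ι) (x : ι → Prop) (g : C.Gate) (S : Finset C.Gate)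
    (h : C.op g = .or S) : C.eval x g ↔ ∃ g' ∈ S, C.eval x g' := by
  rw [eval]; split <;> simp_all

/-- The circuit accepts the word `w` over the alphabet `α`.  The literal `(i, a)` stands for
"the letter in position `i` is `a`". -/
def Accepts {n : ℕ} {α : Type} (C : Circuit (Fin n × α)) (w : Fin n → α) : Prop :=
  C.eval (fun q => w q.1 = q.2) C.out

end Circuit

/-- The language `L` is in (non-uniform) `NC¹`: for each `n` its words of length `n` are decided
by a circuit of fan-in at most two, polynomial size and depth `O(log n)`. -/
def InNC1 {α : Type} (L : Language α) : Prop :=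
  ∃ c : ℕ, ∀ n : ℕ, ∃ C : Circuit (Fin n × α),
    C.FanInTwo ∧ C.size ≤ n ^ c + c ∧ C.depth ≤ c * Nat.log 2 n + c ∧
      ∀ w : Fin n → α, C.Accepts w ↔ List.ofFn w ∈ L

/-- (Non-uniform) `AC⁰` many-one reducibility: words of length `n` are mapped to words of
polynomial length `m`, the reduction preserves membership and non-membership, and each literal of
the image word is computed by a circuit of unbounded fan-in, polynomial size and constant depth. -/
def AC0Reducible {α β : Type} (L : Language α) (L' : Language β) : Prop :=
  ∃ c : ℕ, ∀ n : ℕ, ∃ m : ℕ, m ≤ n ^ c + c ∧ ∃ f : (Fin n → α) → (Fin m → β),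
    (∀ w : Fin n → α, List.ofFn w ∈ L ↔ List.ofFn (f w) ∈ L') ∧
      ∀ (j : Fin m) (b : β), ∃ C : Circuit (Fin n × α),
        C.size ≤ n ^ c + c ∧ C.depth ≤ c ∧ ∀ w : Fin n → α, C.Accepts w ↔ f w j = b

/-- `L` is complete for `NC¹` under `AC⁰`-reductions. -/
def NC1Complete {β : Type} (L : Language β) : Prop :=
  InNC1 L ∧ ∀ (α : Type) [Finite α] (L' : Language α), InNC1 L' → AC0Reducible L' L

/-! ## Iterated swaps of five elements -/

/-- The 20 instructions `[x ↔ y]` with `x ≠ y`. -/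
abbrev Swap : Type := {q : Fin 5 × Fin 5 // q.1 ≠ q.2}

/-- The transposition performed by an instruction. -/
def Swap.perm (s : Swap) : Equiv.Perm (Fin 5) := Equiv.swap s.1.1 s.1.2

/-- The sequences of swaps that compose to the identity permutation. -/
def swapIdentity : Language Swap := {w | (w.map Swap.perm).prod = 1}

theorem mem_swapIdentity (w : List Swap) :
    w ∈ swapIdentity ↔ (w.map Swap.perm).prod = 1 := Iff.rfl

/-- The 21 tokens: the start token `#` and the swaps. -/
inductive Token : Type
  | start : Token
  | swap (s : Swap) : Token

/-- The token sequence `# [a₁ ↔ b₁] … [aₙ ↔ bₙ]`. -/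
def tokens (w : List Swap) : List Token := Token.start :: w.map Token.swap

/-! ## Finite precision -/

/-- Floating-point numbers with precision `p`: `m · 2 ^ e`, where `m` and `e` are signed integers
of `p` bits each (plus the sign). -/
def floats (p : ℕ) : Set ℝ :=
  {x | ∃ m e : ℤ, |m| < 2 ^ p ∧ |e| < 2 ^ p ∧ x = (m : ℝ) * (2 : ℝ) ^ e}

/-- `r` is a rounding to precision `p`: monotone, with values in the floating-point numbers, and
exact on them.  Rounding to nearest with any rule for ties, truncation towards zero, and rounding
up or down (all saturating on overflow) are of this kind. -/
structure IsRounding (p : ℕ) (r : ℝ → ℝ) : Prop where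
  monotone : Monotone r
  mem : ∀ x, r x ∈ floats p
  exact : ∀ x ∈ floats p, r x = x

/-- Entrywise rounding. -/
def roundVec {d : ℕ} (r : ℝ → ℝ) (v : Fin d → ℝ) : Fin d → ℝ := fun a => r (v a)

/-! ## PaTH attention -/

/-- The parameters of a PaTH attention head with model dimension `D` and head dimension `d`. -/
structure Head (D d : ℕ) where
  Wq : Matrix (Fin d) (Fin D) ℝ
  Wk : Matrix (Fin d) (Fin D) ℝ
  Wv : Matrix (Fin d) (Fin D) ℝ
  Ww : Matrix (Fin d) (Fin D) ℝ
  u : Fin D → ℝ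
  b : ℝ

namespace Head

open Matrix

variable {D d : ℕ}

/-- All parameters are floating-point numbers of precision `p`. -/
def Representable (P : Head D d) (p : ℕ) : Prop :=
  (∀ a c, P.Wq a c ∈ floats p) ∧ (∀ a c, P.Wk a c ∈ floats p) ∧ (∀ a c, P.Wv a c ∈ floats p) ∧
    (∀ a c, P.Ww a c ∈ floats p) ∧ (∀ c, P.u c ∈ floats p) ∧ P.b ∈ floats p

/-- The query vector of an input vector. -/
def query (P : Head D d) (r : ℝ → ℝ) (x : Fin D → ℝ) : Fin d → ℝ := roundVec r (P.Wq *ᵥ x)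

/-- The key vector of an input vector. -/
def key (P : Head D d) (r : ℝ → ℝ) (x : Fin D → ℝ) : Fin d → ℝ := roundVec r (P.Wk *ᵥ x)

/-- The value vector of an input vector. -/
def value (P : Head D d) (r : ℝ → ℝ) (x : Fin D → ℝ) : Fin d → ℝ := roundVec r (P.Wv *ᵥ x)

/-- The coefficient `β = 2 sigmoid(uᵀx + b)`. -/
noncomputable def beta (P : Head D d) (r : ℝ → ℝ) (x : Fin D → ℝ) : ℝ :=
  r (2 * Real.sigmoid (r (P.u ⬝ᵥ x + P.b)))

/-- The linear image of the input vector that is normalized to give the direction `w`. -/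
def preDir (P : Head D d) (r : ℝ → ℝ) (x : Fin D → ℝ) : Fin d → ℝ := roundVec r (P.Ww *ᵥ x)

/-- The direction `w`: the linear image of the input, divided by its Euclidean norm (and `0` if
the linear image is `0`). -/
noncomputable def dir (P : Head D d) (r : ℝ → ℝ) (x : Fin D → ℝ) : Fin d → ℝ :=
  roundVec r (fun a => P.preDir r x a / √(P.preDir r x ⬝ᵥ P.preDir r x))

/-- The transition matrix `H = I - β w wᵀ`. -/
noncomputable def transition (P : Head D d) (r : ℝ → ℝ) (x : Fin D → ℝ) :
    Matrix (Fin d) (Fin d) ℝ :=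
  Matrix.of fun a c => r ((1 : Matrix (Fin d) (Fin d) ℝ) a c - P.beta r x * P.dir r x a * P.dir r x c)

/-- The row vector `k_jᵀ H_{j+1} H_{j+2} ⋯ H_{j+t}`, computed from left to right. -/
noncomputable def carry (P : Head D d) (r : ℝ → ℝ) (X : ℕ → Fin D → ℝ) (j : ℕ) : ℕ → Fin d → ℝ
  | 0 => P.key r (X j)
  | t + 1 => roundVec r (P.carry r X j t ᵥ* P.transition r (X (j + (t + 1))))

/-- The attention logit `k_jᵀ (H_{j+1} ⋯ H_i) q_i` from position `i` to position `j ≤ i`. -/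
noncomputable def logit (P : Head D d) (r : ℝ → ℝ) (X : ℕ → Fin D → ℝ) (i j : ℕ) : ℝ :=
  r (P.carry r X j (i - j) ⬝ᵥ P.query r (X i))

/-- The unnormalized attention weight. -/
noncomputable def score (P : Head D d) (r : ℝ → ℝ) (X : ℕ → Fin D → ℝ) (i j : ℕ) : ℝ :=
  r (Real.exp (P.logit r X i j))

/-- The softmax normalizer; attention is causal, over the positions `0, …, i`. -/
noncomputable def normalizer (P : Head D d) (r : ℝ → ℝ) (X : ℕ → Fin D → ℝ) (i : ℕ) : ℝ :=
  r (∑ j ∈ Finset.range (i + 1), P.score r X i j)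

/-- The attention weight. -/
noncomputable def weight (P : Head D d) (r : ℝ → ℝ) (X : ℕ → Fin D → ℝ) (i j : ℕ) : ℝ :=
  r (P.score r X i j / P.normalizer r X i)

/-- The output of the head in position `i`. -/
noncomputable def output (P : Head D d) (r : ℝ → ℝ) (X : ℕ → Fin D → ℝ) (i : ℕ) : Fin d → ℝ :=
  fun a => r (∑ j ∈ Finset.range (i + 1), P.weight r X i j * P.value r (X j) a)

end Head

/-- The parameters of a one-layer PaTH transformer over the vocabulary `V` with `h` attention
heads, model dimension `D`, head dimension `d` and feed-forward width `k`: token embeddings,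
heads, output projection of the concatenated heads, and a feed-forward layer with scalar output. -/
structure OneLayer (V : Type) (h D d k : ℕ) where
  emb : V → Fin D → ℝ
  head : Fin h → Head D d
  Wo : Matrix (Fin D) (Fin h × Fin d) ℝ
  W₁ : Matrix (Fin k) (Fin D) ℝ
  b₁ : Fin k → ℝ
  W₂ : Fin k → ℝ
  b₂ : ℝ

namespace OneLayer

open Matrix

variable {V : Type} {h D d k : ℕ}

/-- All parameters are floating-point numbers of precision `p`. -/
def Representable (T : OneLayer V h D d k) (p : ℕ) : Prop :=
  (∀ v c, T.emb v c ∈ floats p) ∧ (∀ m, (T.head m).Representable p) ∧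
    (∀ c q, T.Wo c q ∈ floats p) ∧ (∀ l c, T.W₁ l c ∈ floats p) ∧ (∀ l, T.b₁ l ∈ floats p) ∧
      (∀ l, T.W₂ l ∈ floats p) ∧ T.b₂ ∈ floats p

/-- The embedded input sequence (positions beyond its end are never attended to). -/
def embed (T : OneLayer V h D d k) (s : List V) : ℕ → Fin D → ℝ :=
  fun t => (s.map T.emb).getD t 0

/-- The projected concatenation of the outputs of the heads in position `i`. -/
noncomputable def attention (T : OneLayer V h D d k) (r : ℝ → ℝ) (s : List V) (i : ℕ) :
    Fin D → ℝ :=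
  roundVec r (T.Wo *ᵥ fun q => (T.head q.1).output r (T.embed s) i q.2)

/-- The feed-forward layer, with nonlinearity `sign`. -/
noncomputable def ffn (T : OneLayer V h D d k) (r : ℝ → ℝ) (y : Fin D → ℝ) : ℝ :=
  r (T.W₂ ⬝ᵥ (fun l => Real.sign (r ((T.W₁ *ᵥ y) l + T.b₁ l))) + T.b₂)

/-- The output of the transformer on a sequence, computed with the rounding `r`: the output of the
feed-forward layer in the last position. -/
noncomputable def run (T : OneLayer V h D d k) (r : ℝ → ℝ) (s : List V) : ℝ :=
  T.ffn r (T.attention r s (s.length - 1))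

end OneLayer

end PaTH

namespace PaTH

/-! Part (a). A product of swaps is evaluated by a balanced binary tree: a block has product `σ` iff
for some `τ` its left half has product `τ` and its right half `τ⁻¹ * σ`. Since the group is fixed,
each level of the tree costs constant depth, which gives `inNC1_swapIdentity`. Hardness is
Barrington's theorem, `Circuit.FanInTwo.programmable`: by induction on the level, for each gate and
each 5-cycle `σ` there is a program whose product is `σ` if the gate is true and `1` otherwise.
Conjunction becomes a commutator, which works because every 5-cycle is a commutator of 5-cycles. A
5-cycle is a product of four transpositions, so swaps suffice as instructions, and each instruction
reads at most one letter, so the reduction has constant depth.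

Part (b). For `β` close to `2` and `w` close to `(e_x - e_y) / √2`, the matrix `H` is close to the
permutation matrix of `(x y)`. Hence the key `(1, …, 5)` of the start token is carried to the vector
with entries close to `σ a + 1`, where `σ` is the product of the swaps. The inner product of the
exact vector with `(1, …, 5)` is 55 for `σ = 1` and at most 54 otherwise (`sum_mul_perm_le`). An
affine change of the query, scaled by `logScale n`, turns this gap into an exact logit of `15 *
logScale n` against at most `-15 * logScale n`. Swap tokens have key zero and score 1, so the start
token has weight at least 1/4 or at most 1/16 (`weight_start_ge`, `weight_start_le`), and the
feed-forward layer compares with 1/8.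

Permuting entries does not amplify errors, so each step adds `O(2 ^ (-p))` to the error of the
carried key, and `p = log n + O(1)` keeps the total tiny (`abs_carry_start_sub_le`). From the logit
on, only monotonicity of the rounding and its exactness at suitable representable bounds are needed.
-/

/-! ## Combining circuits -/

/-- The operation of a gate of a circuit that is embedded in another one. -/
def GateOp.map {ι G G' : Type} (f : G ↪ G') : GateOp ι G → GateOp ι G'
  | .input i => .input i
  | .not g => .not (f g)
  | .and S => .and (S.map f)
  | .or S => .or (S.map f)

theorem GateOp.children_map {ι G G' : Type} (f : G ↪ G') (o : GateOp ι G) :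
    (o.map f).children = o.children.map f := by
  cases o <;> simp [GateOp.map, GateOp.children]

theorem GateOp.card_children_map {ι G G' : Type} (f : G ↪ G') (o : GateOp ι G) :
    (o.map f).children.card = o.children.card := by
  rw [GateOp.children_map, Finset.card_map]

/-- The value of a gate depends only on the gates below it, and `f` carries these along with their
wiring; induction on the level. -/
theorem Circuit.eval_embed {ι : Type} (C C' : Circuit ι) (f : C.Gate ↪ C'.Gate)
    (hf : ∀ g, C'.op (f g) = (C.op g).map f) (x : ι → Prop) (g : C.Gate) :
    C'.eval x (f g) ↔ C.eval x g := by
  induction hl : C.level g using Nat.strong_induction_on generalizing g with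
  | _ l ih =>
    subst hl
    have ih' : ∀ g' ∈ (C.op g).children, (C'.eval x (f g') ↔ C.eval x g') := fun g' hg' =>
      ih _ (C.level_lt g g' hg') g' rfl
    have hg := hf g
    cases h : C.op g with
    | input i =>
      rw [h] at hg
      rw [C.eval_input x g i h, C'.eval_input x (f g) i hg]
    | not g' =>
      rw [h] at hg ih'
      rw [C.eval_not x g g' h, C'.eval_not x (f g) (f g') hg, ih' g' (by simp [GateOp.children])]
    | and S =>
      rw [h] at hg ih'
      rw [C.eval_and x g S h, C'.eval_and x (f g) (S.map f) hg, Finset.forall_mem_map]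
      exact forall₂_congr fun g' hg' => ih' g' hg'
    | or S =>
      rw [h] at hg ih'
      rw [C.eval_or x g S h, C'.eval_or x (f g) (S.map f) hg]
      simp only [Finset.mem_map, exists_exists_and_eq_and]
      exact exists_congr fun g' => and_congr_right fun hg' => ih' g' hg'

/-- A circuit with a single gate. -/
def Circuit.single {ι : Type} (o : GateOp ι Unit) (ho : o.children = ∅) : Circuit ι where
  Gate := Unit
  fintypeGate := inferInstance
  op := fun _ => o
  level := fun _ => 0
  level_lt := by simp [ho]
  out := ()

/-- The negation of a circuit. -/
def Circuit.neg {ι : Type} (C : Circuit ι) : Circuit ι where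
  Gate := Option C.Gate
  fintypeGate := @instFintypeOption _ C.fintypeGate
  op := fun
    | none => .not (some C.out)
    | some g => (C.op g).map Function.Embedding.some
  level := fun
    | none => C.level C.out + 1
    | some g => C.level g
  level_lt := by
    rintro (_ | g) g' hg'
    · obtain rfl : g' = some C.out := by simpa [GateOp.children] using hg'
      simp
    · rw [GateOp.children_map, Finset.mem_map] at hg'
      obtain ⟨g'', hg'', rfl⟩ := hg'
      exact C.level_lt g g'' hg''
  out := none

/-- The output gates of two circuits, side by side. -/
def Circuit.outPair {ι : Type} (C C' : Circuit ι) : Finset (Option (C.Gate ⊕ C'.Gate)) :=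
  Finset.cons (some (.inl C.out)) {some (.inr C'.out)} (by simp)

theorem Circuit.card_outPair {ι : Type} (C C' : Circuit ι) : (C.outPair C').card = 2 := by
  simp [outPair]

theorem Circuit.forall_mem_outPair {ι : Type} (C C' : Circuit ι)
    {q : Option (C.Gate ⊕ C'.Gate) → Prop} :
    (∀ g ∈ C.outPair C', q g) ↔ q (some (.inl C.out)) ∧ q (some (.inr C'.out)) := by
  simp [outPair]

/-- The conjunction of two circuits. -/
def Circuit.conj {ι : Type} (C C' : Circuit ι) : Circuit ι where
  Gate := Option (C.Gate ⊕ C'.Gate)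
  fintypeGate := @instFintypeOption _ (@instFintypeSum _ _ C.fintypeGate C'.fintypeGate)
  op := fun
    | none => .and (C.outPair C')
    | some (.inl g) => (C.op g).map (Function.Embedding.inl.trans Function.Embedding.some)
    | some (.inr g) => (C'.op g).map (Function.Embedding.inr.trans Function.Embedding.some)
  level := fun
    | none => max (C.level C.out) (C'.level C'.out) + 1
    | some (.inl g) => C.level g
    | some (.inr g) => C'.level g
  level_lt := by
    rintro (_ | g | g) g' hg'
    · have : g' = some (.inl C.out) ∨ g' = some (.inr C'.out) := by
        simpa [GateOp.children, outPair] using hg'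
      rcases this with rfl | rfl <;> simp
    · rw [GateOp.children_map, Finset.mem_map] at hg'
      obtain ⟨g'', hg'', rfl⟩ := hg'
      exact C.level_lt g g'' hg''
    · rw [GateOp.children_map, Finset.mem_map] at hg'
      obtain ⟨g'', hg'', rfl⟩ := hg'
      exact C'.level_lt g g'' hg''
  out := none

/-- The property `φ` of words of length `n` is decided by a circuit of fan-in two and depth `d`
that is no larger than a formula of this depth. -/
def DecidedInDepth {n : ℕ} {α : Type} (d : ℕ) (φ : (Fin n → α) → Prop) : Prop :=
  ∃ C : Circuit (Fin n × α), C.FanInTwo ∧ C.size < 2 ^ (d + 1) ∧ C.depth ≤ d ∧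
    ∀ w, C.Accepts w ↔ φ w

namespace DecidedInDepth

variable {n : ℕ} {α : Type} {d d' : ℕ} {φ ψ : (Fin n → α) → Prop}

theorem mono (h : DecidedInDepth d φ) (hd : d ≤ d') : DecidedInDepth d' φ := by
  obtain ⟨C, h1, h2, h3, h4⟩ := h
  exact ⟨C, h1, h2.trans_le (Nat.pow_le_pow_right two_pos (by omega)), h3.trans hd, h4⟩

theorem congr (h : DecidedInDepth d φ) (hφ : ∀ w, φ w ↔ ψ w) : DecidedInDepth d ψ := by
  obtain rfl : φ = ψ := funext fun w => propext (hφ w)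
  exact h

theorem single (o : GateOp (Fin n × α) Unit) (ho : o.children = ∅)
    (h : ∀ w, (Circuit.single o ho).Accepts w ↔ φ w) : DecidedInDepth d φ := by
  refine mono (d := 0) ⟨Circuit.single o ho, fun g => ?_, ?_, le_rfl, h⟩ (Nat.zero_le d)
  · have : ((Circuit.single o ho).op g).children = ∅ := ho
    rw [this]; exact Nat.zero_le _
  · change @Fintype.card Unit inferInstance < _
    simp

theorem literal (i : Fin n) (a : α) : DecidedInDepth d fun w => w i = a :=
  single (.input (i, a)) rfl fun w =>
    (Circuit.single (.input (i, a)) rfl).eval_input (fun q => w q.1 = q.2) () (i, a) rfl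

theorem const (P : Prop) : DecidedInDepth (n := n) (α := α) d fun _ => P := by
  by_cases hP : P
  · refine single (.and ∅) rfl fun _ => (Circuit.eval_and _ _ _ _ rfl).trans ?_
    exact iff_of_true (fun g' hg' => absurd hg' (Finset.notMem_empty g')) hP
  · refine single (.or ∅) rfl fun _ => (Circuit.eval_or _ _ _ _ rfl).trans ?_
    exact iff_of_false (fun ⟨g', hg', _⟩ => Finset.notMem_empty g' hg') hP

theorem not (h : DecidedInDepth d φ) : DecidedInDepth (d + 1) fun w => ¬ φ w := by
  obtain ⟨C, h1, h2, h3, h4⟩ := h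
  refine ⟨C.neg, ?_, ?_, Nat.succ_le_succ h3, fun w => ?_⟩
  · rintro (_ | g)
    · exact (Finset.card_singleton _).trans_le one_le_two
    · exact (GateOp.card_children_map _ _).trans_le (h1 g)
  · have : C.neg.size = C.size + 1 := @Fintype.card_option _ C.fintypeGate
    rw [this, pow_succ]
    omega
  · beta_reduce
    rw [← h4, Circuit.Accepts, Circuit.eval_not _ _ C.neg.out (some C.out) rfl]
    exact not_congr (Circuit.eval_embed C C.neg Function.Embedding.some (fun _ => rfl) _ _)

theorem and (h : DecidedInDepth d φ) (h' : DecidedInDepth d ψ) :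
    DecidedInDepth (d + 1) fun w => φ w ∧ ψ w := by
  obtain ⟨C, h1, h2, h3, h4⟩ := h
  obtain ⟨C', h1', h2', h3', h4'⟩ := h'
  refine ⟨C.conj C', ?_, ?_, Nat.succ_le_succ (max_le h3 h3'), fun w => ?_⟩
  · rintro (_ | g | g)
    · exact (C.card_outPair C').le
    · exact (GateOp.card_children_map _ _).trans_le (h1 g)
    · exact (GateOp.card_children_map _ _).trans_le (h1' g)
  -- Two sizes below `2 ^ (d + 1)` plus one new gate stay below `2 ^ (d + 2)`, so logarithmic depth
  -- will give polynomial size for free.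
  · have : (C.conj C').size = C.size + C'.size + 1 :=
      (@Fintype.card_option _ (@instFintypeSum _ _ C.fintypeGate C'.fintypeGate)).trans
        (congrArg (· + 1) (@Fintype.card_sum _ _ C.fintypeGate C'.fintypeGate))
    rw [this, pow_succ]
    omega
  · beta_reduce
    rw [← h4, ← h4']
    refine (Circuit.eval_and _ _ (C.conj C').out _ rfl).trans <|
      (C.forall_mem_outPair C').trans <| and_congr
      (Circuit.eval_embed C (C.conj C') (Function.Embedding.inl.trans Function.Embedding.some)
        (fun _ => rfl) _ _)
      (Circuit.eval_embed C' (C.conj C') (Function.Embedding.inr.trans Function.Embedding.some)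
        (fun _ => rfl) _ _)

theorem or (h : DecidedInDepth d φ) (h' : DecidedInDepth d ψ) :
    DecidedInDepth (d + 3) fun w => φ w ∨ ψ w :=
  (h.not.and h'.not).not.congr fun w => by tauto

/-- A chain of disjunctions is good enough: it is applied only to subsets of the alphabet and to the
group, whose sizes do not depend on `n`. -/
theorem exists_mem {β : Type} (s : Finset β) {φ : β → (Fin n → α) → Prop}
    (h : ∀ b, DecidedInDepth d (φ b)) :
    DecidedInDepth (d + 3 * s.card) fun w => ∃ b ∈ s, φ b w := by
  classical
  induction s using Finset.induction_on with
  | empty => exact (const False).congr fun w => by simp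
  | insert b s hb ih =>
    rw [Finset.card_insert_of_notMem hb]
    exact ((h b).mono (Nat.le_add_right _ _) |>.or ih).congr fun w => by simp

/-- Products of permutations are computed by a balanced tree. -/
theorem prod_eq {G : Type} [Group G] [Fintype G] [Fintype α] (f : α → G) (k : ℕ)
    (l : List (Fin n)) (hl : l.length ≤ 2 ^ k) (σ : G) :
    DecidedInDepth ((3 * Fintype.card G + 1) * k + 3 * Fintype.card α)
      fun w => (l.map fun i => f (w i)).prod = σ := by
  classical
  induction k generalizing l σ with
  | zero =>
    match l, hl with
    | [], _ => exact (const (1 = σ)).congr fun w => by simp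
    | [i], _ =>
      refine ((exists_mem (d := 0) (Finset.univ.filter fun a => f a = σ)
        fun a => literal i a).mono ?_).congr fun w => by simp
      have := Finset.card_filter_le Finset.univ fun a => f a = σ
      rw [Finset.card_univ] at this
      omega
  | succ k ih =>
    rw [pow_succ] at hl
    have h1 := ih (l.take (2 ^ k)) (by simp)
    have h2 := ih (l.drop (2 ^ k)) (by simp; omega)
    -- Guess the product `τ` of the first half; the second half must then be `τ⁻¹ * σ`.
    refine ((exists_mem Finset.univ fun τ => (h1 τ).and (h2 (τ⁻¹ * σ))).mono ?_).congr
      fun w => ?_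
    · rw [Finset.card_univ]; apply le_of_eq; ring
    · conv_rhs => rw [← List.take_append_drop (2 ^ k) l]
      rw [List.map_append, List.prod_append]
      constructor
      · rintro ⟨τ, -, h3, h4⟩
        rw [h3, h4, mul_inv_cancel_left]
      · intro h
        exact ⟨_, Finset.mem_univ _, rfl, by rw [← h, inv_mul_cancel_left]⟩

end DecidedInDepth

/-! ## Polynomial bounds -/

theorem pow_add_self_mono (n : ℕ) {c c' : ℕ} (h : c ≤ c') : n ^ c + c ≤ n ^ c' + c' := by
  -- The case `n = 0` is separate because `0 ^ 0 = 1` makes the power non-monotone in the exponent.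
  rcases Nat.eq_zero_or_pos n with rfl | hn
  · rcases Nat.eq_zero_or_pos c with rfl | hc
    · rcases Nat.eq_zero_or_pos c' with rfl | hc'
      · exact le_rfl
      · rw [pow_zero]
        exact hc'.trans_le (Nat.le_add_left _ _)
    · rw [zero_pow (by omega), zero_pow (by omega)]; omega
  · exact add_le_add (Nat.pow_le_pow_right hn h) h

theorem exists_two_pow_log_le (a b : ℕ) : ∃ c : ℕ, ∀ n : ℕ,
    2 ^ (a * Nat.log 2 n + b) ≤ n ^ c + c := by
  -- As a summand, `2 ^ b` covers `n < 2`, where the logarithm is 0; as an exponent, it absorbs the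
  -- factor `2 ^ b ≤ n ^ 2 ^ b` for `n ≥ 2`.
  refine ⟨a + 2 ^ b, fun n => ?_⟩
  rcases Nat.lt_or_ge n 2 with hn | hn
  · rw [Nat.log_of_lt hn, mul_zero, zero_add]; omega
  · calc 2 ^ (a * Nat.log 2 n + b) = (2 ^ Nat.log 2 n) ^ a * 2 ^ b := by
          rw [pow_add, mul_comm a, pow_mul]
      _ ≤ n ^ a * n ^ 2 ^ b := by
          refine Nat.mul_le_mul (Nat.pow_le_pow_left (Nat.pow_log_le_self 2 (by omega)) a) ?_
          exact Nat.lt_two_pow_self.le.trans (Nat.pow_le_pow_left hn _)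
      _ = n ^ (a + 2 ^ b) := (pow_add _ _ _).symm
      _ ≤ _ := Nat.le_add_right _ _

/-! ### Membership in `NC¹`. -/

theorem inNC1_swapIdentity : InNC1 swapIdentity := by
  -- All that matters about the constants is that they do not depend on `n`.
  obtain ⟨A, B, hAB⟩ : ∃ A B : ℕ, ∀ (n k : ℕ) (l : List (Fin n)), l.length ≤ 2 ^ k →
      DecidedInDepth (A * k + B) fun w : Fin n → Swap => (l.map fun i => (w i).perm).prod = 1 :=
    ⟨_, _, fun n k l hl => DecidedInDepth.prod_eq Swap.perm k l hl 1⟩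
  obtain ⟨c, hc⟩ := exists_two_pow_log_le A (A + B + 1)
  refine ⟨c + A + B, fun n => ?_⟩
  have hn : (List.finRange n).length ≤ 2 ^ (Nat.log 2 n + 1) := by
    rw [List.length_finRange]
    exact (Nat.lt_pow_succ_log_self one_lt_two n).le
  obtain ⟨C, h1, h2, h3, h4⟩ := hAB n _ _ hn
  refine ⟨C, h1, ?_, h3.trans ?_, fun w => (h4 w).trans ?_⟩
  · refine h2.le.trans (le_trans (le_of_eq ?_) ((hc n).trans (pow_add_self_mono n (by omega))))
    congr 1; ring
  · calc A * (Nat.log 2 n + 1) + B = A * Nat.log 2 n + (A + B) := by ring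
      _ ≤ _ := by gcongr <;> omega
  · rw [mem_swapIdentity, List.ofFn_eq_map, List.map_map]
    rfl

/-! ## Swap programs -/

/-- A swap that depends on at most one letter of the input. -/
def IsInstruction {n : ℕ} {α : Type} (f : (Fin n → α) → Swap) : Prop :=
  (∃ s, ∀ w, f w = s) ∨ ∃ (i : Fin n) (a : α) (s t : Swap),
    ∀ w, (w i = a → f w = s) ∧ (w i ≠ a → f w = t)

theorem IsInstruction.decidedInDepth {n : ℕ} {α : Type} {f : (Fin n → α) → Swap}
    (hf : IsInstruction f) (b : Swap) : DecidedInDepth 1 fun w => f w = b := by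
  rcases hf with ⟨s, hs⟩ | ⟨i, a, s, t, hf⟩
  · exact (DecidedInDepth.const (s = b)).congr fun w => by rw [hs w]
  · have h : ∀ w, f w = b ↔ (w i = a ∧ s = b) ∨ (w i ≠ a ∧ t = b) := fun w => by
      by_cases hw : w i = a
      · simp [hw, (hf w).1 hw]
      · simp [hw, (hf w).2 hw]
    simp only [h]
    by_cases hs : s = b <;> by_cases ht : t = b
    · exact (DecidedInDepth.const True).congr fun w => by tauto
    · exact (DecidedInDepth.literal i a).congr fun w => by tauto
    · exact (DecidedInDepth.literal (d := 0) i a).not.congr fun w => by tauto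
    · exact (DecidedInDepth.const False).congr fun w => by tauto

/-- The product of the swaps of a program on an input. -/
def programValue {n : ℕ} {α : Type} (l : List ((Fin n → α) → Swap)) (w : Fin n → α) :
    Equiv.Perm (Fin 5) := (l.map fun f => (f w).perm).prod

theorem programValue_append {n : ℕ} {α : Type} (l l' : List ((Fin n → α) → Swap))
    (w : Fin n → α) : programValue (l ++ l') w = programValue l w * programValue l' w := by
  simp [programValue]

/-- The transposition `(x y)` as an instruction. -/
def mkSwap (x y : Fin 5) (h : x ≠ y) : Swap := ⟨(x, y), h⟩

/-- A factorization of a `5`-cycle into transpositions. -/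
def cycleSwaps : List Swap :=
  [mkSwap 0 1 (by decide), mkSwap 1 2 (by decide), mkSwap 2 3 (by decide), mkSwap 3 4 (by decide)]

/-- The `5`-cycle `0 ↦ 1 ↦ 2 ↦ 3 ↦ 4 ↦ 0`. -/
def fiveCycle : Equiv.Perm (Fin 5) := (cycleSwaps.map Swap.perm).prod

theorem fiveCycle_ne_one : fiveCycle ≠ 1 := by decide

theorem isConj_fiveCycle_inv {σ : Equiv.Perm (Fin 5)} (h : IsConj fiveCycle σ) :
    IsConj fiveCycle σ⁻¹ := by
  obtain ⟨τ, rfl⟩ := isConj_iff.1 h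
  have h0 : IsConj fiveCycle fiveCycle⁻¹ :=
    -- The reflection `i ↦ 4 - i` of the pentagon reverses the cycle.
    isConj_iff.2 ⟨Equiv.swap 0 4 * Equiv.swap 1 3, by decide⟩
  refine h0.trans (isConj_iff.2 ⟨τ, ?_⟩)
  group

set_option maxRecDepth 10000 in
/-- Every `5`-cycle is a commutator of `5`-cycles. -/
theorem exists_commutator_eq {σ : Equiv.Perm (Fin 5)} (h : IsConj fiveCycle σ) :
    ∃ a b, IsConj fiveCycle a ∧ IsConj fiveCycle b ∧ σ = a * b * a⁻¹ * b⁻¹ := by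
  obtain ⟨τ, rfl⟩ := isConj_iff.1 h
  obtain ⟨ρ, ρ', hρ⟩ : ∃ ρ ρ' : Equiv.Perm (Fin 5), fiveCycle =
      (ρ * fiveCycle * ρ⁻¹) * (ρ' * fiveCycle * ρ'⁻¹) * (ρ * fiveCycle * ρ⁻¹)⁻¹ *
        (ρ' * fiveCycle * ρ'⁻¹)⁻¹ := by
    exact ⟨Equiv.swap 0 1 * Equiv.swap 0 3, Equiv.swap 0 1 * Equiv.swap 1 4,
      Equiv.ext (by decide)⟩
  refine ⟨τ * (ρ * fiveCycle * ρ⁻¹) * τ⁻¹, τ * (ρ' * fiveCycle * ρ'⁻¹) * τ⁻¹,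
    isConj_iff.2 ⟨τ * ρ, by group⟩, isConj_iff.2 ⟨τ * ρ', by group⟩, ?_⟩
  conv_lhs => rw [hρ]
  group

/-- Conjugating `(x y)` by `τ` gives `(τ x τ y)`, so the factorization of `fiveCycle` is transported
to its conjugates. -/
theorem exists_swaps_eq {σ : Equiv.Perm (Fin 5)} (h : IsConj fiveCycle σ) :
    ∃ l : List Swap, l.length = 4 ∧ (l.map Swap.perm).prod = σ := by
  obtain ⟨τ, rfl⟩ := isConj_iff.1 h
  refine ⟨cycleSwaps.map fun s => mkSwap (τ s.1.1) (τ s.1.2) (τ.injective.ne s.2), rfl, ?_⟩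
  have h1 : ∀ s : Swap, (mkSwap (τ s.1.1) (τ s.1.2) (τ.injective.ne s.2)).perm =
      MulAut.conj τ s.perm := fun s => by
    simp [Swap.perm, mkSwap, Equiv.swap_apply_apply]
  rw [List.map_map, fiveCycle, ← MulAut.conj_apply, map_list_prod, List.map_map]
  exact congrArg List.prod (List.map_congr_left fun s _ => h1 s)

/-- For each `5`-cycle `σ` there is a swap program of length at most `N` that yields `σ` on the
inputs with the property `φ`, and the identity on the others. -/
def Programmable {n : ℕ} {α : Type} (N : ℕ) (φ : (Fin n → α) → Prop) : Prop :=
  ∀ σ, IsConj fiveCycle σ → ∃ l : List ((Fin n → α) → Swap), (∀ f ∈ l, IsInstruction f) ∧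
    l.length ≤ N ∧ ∀ w, (φ w → programValue l w = σ) ∧ (¬ φ w → programValue l w = 1)

namespace Programmable

variable {n : ℕ} {α : Type} {N N' : ℕ} {φ ψ : (Fin n → α) → Prop}

theorem mono (h : Programmable N φ) (hN : N ≤ N') : Programmable N' φ := fun σ hσ => by
  obtain ⟨l, h1, h2, h3⟩ := h σ hσ
  exact ⟨l, h1, h2.trans hN, h3⟩

theorem congr (h : Programmable N φ) (hφ : ∀ w, φ w ↔ ψ w) : Programmable N ψ := by
  obtain rfl : φ = ψ := funext fun w => propext (hφ w)
  exact h

theorem true : Programmable (n := n) (α := α) 4 fun _ => True := fun σ hσ => by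
  obtain ⟨l, hl, hprod⟩ := exists_swaps_eq hσ
  refine ⟨l.map fun s _ => s, ?_, by rw [List.length_map, hl], fun w =>
    ⟨fun _ => ?_, fun h => absurd trivial h⟩⟩
  · intro f hf
    obtain ⟨s, -, rfl⟩ := List.mem_map.1 hf
    exact Or.inl ⟨s, fun _ => rfl⟩
  · rw [programValue, List.map_map]; exact hprod

theorem literal (i : Fin n) (a : α) : Programmable 4 fun w => w i = a := fun σ hσ => by
  classical
  obtain ⟨l, hl, hprod⟩ := exists_swaps_eq hσ
  -- There is no idle instruction. On the other inputs all four swaps are the same transposition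
  -- `t`, and `t ^ 4 = 1`.
  set t := mkSwap 0 1 (by decide)
  refine ⟨l.map fun s w => if w i = a then s else t, ?_, by rw [List.length_map, hl], fun w =>
    ⟨fun h => ?_, fun h => ?_⟩⟩
  · intro f hf
    obtain ⟨s, -, rfl⟩ := List.mem_map.1 hf
    exact Or.inr ⟨i, a, s, t, fun w => ⟨fun h => if_pos h, fun h => if_neg h⟩⟩
  · rw [programValue, List.map_map, ← hprod]
    exact congrArg List.prod (List.map_congr_left fun s _ => by simp [h])
  · rw [programValue, List.map_map]
    have : l.map ((fun f => (f w).perm) ∘ fun s w => if w i = a then s else t) =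
        List.replicate 4 t.perm := by
      rw [← hl, ← List.map_const']
      exact List.map_congr_left fun s _ => by simp [h]
    rw [this, List.prod_replicate]
    decide

/-- Run a program for `σ⁻¹` and multiply by the constant `σ`: the values `σ⁻¹` and `1` become `1`
and `σ`. -/
theorem not (h : Programmable N φ) : Programmable (N + 4) fun w => ¬ φ w := fun σ hσ => by
  obtain ⟨l, h1, h2, h3⟩ := h σ⁻¹ (isConj_fiveCycle_inv hσ)
  obtain ⟨l', h1', h2', h3'⟩ := true (n := n) (α := α) σ hσ
  refine ⟨l ++ l', ?_, by rw [List.length_append]; omega, fun w => ⟨fun hw => ?_, fun hw => ?_⟩⟩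
  · intro f hf
    exact (List.mem_append.1 hf).elim (h1 f) (h1' f)
  · rw [programValue_append, (h3 w).2 hw, (h3' w).1 trivial, one_mul]
  · rw [programValue_append, (h3 w).1 (not_not.1 hw), (h3' w).1 trivial, inv_mul_cancel]

/-- Write `σ` as a commutator of 5-cycles `a` and `b`. If either condition fails, one of the two
factors is replaced by `1` and the commutator collapses. -/
theorem and (h : Programmable N φ) (h' : Programmable N ψ) :
    Programmable (4 * N) fun w => φ w ∧ ψ w := fun σ hσ => by
  obtain ⟨a, b, ha, hb, rfl⟩ := exists_commutator_eq hσ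
  obtain ⟨l₁, h1, h2, h3⟩ := h a ha
  obtain ⟨l₂, k1, k2, k3⟩ := h' b hb
  obtain ⟨l₃, h1', h2', h3'⟩ := h a⁻¹ (isConj_fiveCycle_inv ha)
  obtain ⟨l₄, k1', k2', k3'⟩ := h' b⁻¹ (isConj_fiveCycle_inv hb)
  refine ⟨l₁ ++ l₂ ++ l₃ ++ l₄, ?_, by simp only [List.length_append]; omega, fun w => ?_⟩
  · intro f hf
    simp only [List.mem_append] at hf
    rcases hf with ((hf | hf) | hf) | hf
    exacts [h1 f hf, k1 f hf, h1' f hf, k1' f hf]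
  · simp only [programValue_append]
    by_cases hφ : φ w <;> by_cases hψ : ψ w
    · simp [hφ, hψ, (h3 w).1 hφ, (h3' w).1 hφ, (k3 w).1 hψ, (k3' w).1 hψ]
    · simp [hφ, hψ, (h3 w).1 hφ, (h3' w).1 hφ, (k3 w).2 hψ, (k3' w).2 hψ]
    · simp [hφ, hψ, (h3 w).2 hφ, (h3' w).2 hφ, (k3 w).1 hψ, (k3' w).1 hψ]
    · simp [hφ, hψ, (h3 w).2 hφ, (h3' w).2 hφ, (k3 w).2 hψ, (k3' w).2 hψ]

theorem or (h : Programmable N φ) (h' : Programmable N ψ) :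
    Programmable (4 * (N + 4) + 4) fun w => φ w ∨ ψ w :=
  (h.not.and h'.not).not.congr fun w => by tauto

end Programmable

/-- Barrington's theorem. -/
theorem Circuit.FanInTwo.programmable {n : ℕ} {α : Type} {C : Circuit (Fin n × α)}
    (hC : C.FanInTwo) (d : ℕ) (g : C.Gate) (hg : C.level g < d) :
    Programmable (8 ^ (d + 1)) fun w : Fin n → α => C.eval (fun q => w q.1 = q.2) g := by
  classical
  induction d generalizing g with
  | zero => omega
  | succ d ih =>
    -- Disjunction is the most expensive gate: its length `4 * (N + 4) + 4` is at most `8 * N` once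
    -- `N ≥ 5`.
    have hN : 8 ≤ 8 ^ (d + 1) := by
      rw [pow_succ]
      have : 0 < 8 ^ d := by positivity
      omega
    have hN' : 8 ^ (d + 1 + 1) = 8 * 8 ^ (d + 1) := by rw [pow_succ, mul_comm]
    have ih' : ∀ g' ∈ (C.op g).children, Programmable (8 ^ (d + 1))
        fun w : Fin n → α => C.eval (fun q => w q.1 = q.2) g' := fun g' hg' =>
      ih g' ((C.level_lt g g' hg').trans_le (Nat.lt_succ_iff.1 hg))
    have hcard := hC g
    rw [hN']
    generalize 8 ^ (d + 1) = N at hN ih'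
    have hsets : ∀ S : Finset C.Gate, S.card ≤ 2 → S = ∅ ∨ (∃ a, S = {a}) ∨ ∃ a b, S = {a, b} := by
      intro S hS
      have : S.card = 0 ∨ S.card = 1 ∨ S.card = 2 := by omega
      rcases this with h | h | h
      · exact Or.inl (Finset.card_eq_zero.1 h)
      · exact Or.inr (Or.inl (Finset.card_eq_one.1 h))
      · obtain ⟨a, b, -, h⟩ := Finset.card_eq_two.1 h
        exact Or.inr (Or.inr ⟨a, b, h⟩)
    cases h : C.op g with
    | input i =>
      exact ((Programmable.literal i.1 i.2).mono (by omega)).congr fun w =>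
        (C.eval_input (fun q => w q.1 = q.2) g i h).symm
    | not g' =>
      rw [h] at ih'
      exact ((ih' g' (by simp [GateOp.children])).not.mono (by omega)).congr fun w =>
        (C.eval_not _ g g' h).symm
    | and S =>
      rw [h] at ih' hcard
      simp only [C.eval_and _ g S h]
      rcases hsets S hcard with rfl | ⟨a, rfl⟩ | ⟨a, b, rfl⟩
      · exact (Programmable.true.mono (by omega)).congr fun w => by simp
      · exact ((ih' a (by simp [GateOp.children])).mono (by omega)).congr fun w => by simp
      · exact (((ih' a (by simp [GateOp.children])).and (ih' b (by simp [GateOp.children]))).mono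
          (by omega)).congr fun w => by simp
    | or S =>
      rw [h] at ih' hcard
      simp only [C.eval_or _ g S h]
      rcases hsets S hcard with rfl | ⟨a, rfl⟩ | ⟨a, b, rfl⟩
      · exact (Programmable.true.not.mono (by omega)).congr fun w => by simp
      · exact ((ih' a (by simp [GateOp.children])).mono (by omega)).congr fun w => by simp
      · exact (((ih' a (by simp [GateOp.children])).or (ih' b (by simp [GateOp.children]))).mono
          (by omega)).congr fun w => by simp

/-! ### Hardness for `NC¹`. -/

theorem ac0Reducible_swapIdentity {α : Type} {L : Language α} (hL : InNC1 L) :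
    AC0Reducible L swapIdentity := by
  obtain ⟨c, hc⟩ := hL
  obtain ⟨e, he⟩ := exists_two_pow_log_le (3 * c) (3 * c + 10)
  -- The summand 4 accommodates the circuits for single instructions, which have fewer than `2 ^ 2`
  -- gates.
  refine ⟨e + 4, fun n => ?_⟩
  obtain ⟨C, hfan, -, hdepth, hC⟩ := hc n
  -- Negation is needed because accepted words must yield the identity and rejected ones the
  -- 5-cycle.
  obtain ⟨l, h1, h2, h3⟩ := (hfan.programmable (C.depth + 1) C.out (Nat.lt_succ_self _)).not
    fiveCycle (IsConj.refl _)
  refine ⟨l.length, ?_, fun w j => l.get j w, fun w => ?_, fun j b => ?_⟩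
  · refine h2.trans (le_trans ?_ ((he n).trans (pow_add_self_mono n (Nat.le_add_right e 4))))
    calc 8 ^ (C.depth + 1 + 1) + 4 ≤ 2 * 8 ^ (C.depth + 1 + 1) := by
          have : 0 < 8 ^ C.depth := by positivity
          rw [pow_succ, pow_succ]; omega
      _ = 2 ^ (3 * C.depth + 7) := by
          rw [show (8 : ℕ) = 2 ^ 3 by norm_num, ← pow_mul, ← pow_succ']; congr 1
      _ ≤ _ := Nat.pow_le_pow_right two_pos (by rw [mul_assoc]; omega)
  · have hval : ((List.ofFn fun j => l.get j w).map Swap.perm).prod = programValue l w := by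
      rw [programValue, List.ofFn_eq_map, List.map_map]
      conv_rhs => rw [← List.map_get_finRange l, List.map_map]
      rfl
    rw [mem_swapIdentity, hval, ← hC w]
    constructor
    · intro h
      exact (h3 w).2 (not_not.2 h)
    · intro h
      by_contra hw
      exact fiveCycle_ne_one (((h3 w).1 hw).symm.trans h)
  · obtain ⟨C', -, h2', h3', h4'⟩ := (h1 (l.get j) (l.get_mem j)).decidedInDepth b
    refine ⟨C', ?_, h3'.trans (by omega), h4'⟩
    have := Nat.zero_le (n ^ (e + 4))
    omega

theorem nc1Complete_swapIdentity : NC1Complete swapIdentity :=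
  ⟨inNC1_swapIdentity, fun _ _ _ hL => ac0Reducible_swapIdentity hL⟩

/-! ## Floating-point numbers and roundings -/

section Rounding

variable {p : ℕ} {r : ℝ → ℝ}

theorem mul_zpow_mem_floats {m e : ℤ} (hm : |m| < 2 ^ p) (he : |e| < 2 ^ p) :
    (m : ℝ) * (2 : ℝ) ^ e ∈ floats p := ⟨m, e, hm, he, rfl⟩

theorem intCast_mem_floats {m : ℤ} (hm : |m| < 2 ^ p) : (m : ℝ) ∈ floats p :=
  ⟨m, 0, hm, by simp, by simp⟩

theorem zero_mem_floats : (0 : ℝ) ∈ floats p := by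
  simpa using intCast_mem_floats (p := p) (m := 0) (by simp)

theorem zpow_mem_floats (hp : 1 ≤ p) {e : ℤ} (he : |e| < 2 ^ p) : (2 : ℝ) ^ e ∈ floats p := by
  simpa using mul_zpow_mem_floats (p := p) (m := 1) (e := e)
    (by simpa using one_lt_pow₀ (by norm_num : (1 : ℤ) < 2) (by omega)) he

theorem one_mem_floats (hp : 1 ≤ p) : (1 : ℝ) ∈ floats p := by
  simpa using zpow_mem_floats hp (e := 0) (by simp)

theorem neg_mem_floats {x : ℝ} (hx : x ∈ floats p) : -x ∈ floats p := by
  obtain ⟨m, e, hm, he, rfl⟩ := hx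
  exact ⟨-m, e, by rwa [abs_neg], he, by push_cast; ring⟩

namespace IsRounding

theorem le_of_le (hr : IsRounding p r) {x y : ℝ} (hy : y ∈ floats p) (h : x ≤ y) : r x ≤ y :=
  (hr.monotone h).trans_eq (hr.exact y hy)

theorem ge_of_ge (hr : IsRounding p r) {x y : ℝ} (hy : y ∈ floats p) (h : y ≤ x) : y ≤ r x :=
  (hr.exact y hy).symm.trans_le (hr.monotone h)

theorem map_zero (hr : IsRounding p r) : r 0 = 0 := hr.exact 0 zero_mem_floats

theorem map_one (hr : IsRounding p r) (hp : 1 ≤ p) : r 1 = 1 := hr.exact 1 (one_mem_floats hp)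

/-- The absolute rounding error of numbers of moderate size. -/
theorem abs_sub_le (hr : IsRounding p r) (hp : 3 ≤ p) {x : ℝ} (hx : |x| ≤ 7) :
    |r x - x| ≤ 8 / 2 ^ p := by
  have hpp : p < 2 ^ p := Nat.lt_two_pow_self
  have he : |(3 - p : ℤ)| < 2 ^ p := by
    have : (p : ℤ) < 2 ^ p := by exact_mod_cast hpp
    rw [abs_lt]; constructor <;> omega
  have h8 : (2 : ℝ) ^ (3 - p : ℤ) = 8 / 2 ^ p := by
    rw [zpow_sub₀ (by norm_num)]; norm_num
  have h8' : (8 : ℤ) ≤ 2 ^ p := by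
    calc (8 : ℤ) = 2 ^ 3 := by norm_num
      _ ≤ 2 ^ p := pow_le_pow_right₀ (by norm_num) hp
  -- The multiples `m * g` with `|m| < 2 ^ p` are floating-point numbers. Monotonicity traps `r x`
  -- between the two grid points around `x`; the bound 7 instead of 8 keeps both within the range of
  -- `m`.
  set g : ℝ := 8 / 2 ^ p with hg
  have hg0 : 0 < g := by positivity
  obtain ⟨hx1, hx2⟩ := abs_le.1 hx
  have hxg : x / g * 8 = x * 2 ^ p := by rw [hg]; field_simp
  have hP : (0 : ℝ) < 2 ^ p := by positivity
  have hP8 : (8 : ℝ) ≤ 2 ^ p := by exact_mod_cast h8'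
  have hu : x / g ≤ 2 ^ p - 2 ^ p / 8 := by nlinarith
  have hl : -(2 ^ p - 2 ^ p / 8) ≤ x / g := by nlinarith
  have hmem : ∀ m : ℤ, |(m : ℝ)| < 2 ^ p → (m : ℝ) * g ∈ floats p := fun m hm => by
    rw [← h8]; exact mul_zpow_mem_floats (by exact_mod_cast hm) he
  have hceil := hmem ⌈x / g⌉ (by
    have := Int.ceil_lt_add_one (x / g); have := Int.le_ceil (x / g)
    rw [abs_lt]; constructor <;> linarith)
  have hfloor := hmem ⌊x / g⌋ (by
    have := Int.sub_one_lt_floor (x / g); have := Int.floor_le (x / g)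
    rw [abs_lt]; constructor <;> linarith)
  have hxx : x / g * g = x := by field_simp
  have h1 := hr.le_of_le hceil (by
    calc x = x / g * g := hxx.symm
      _ ≤ _ := by gcongr; exact Int.le_ceil _)
  have h2 := hr.ge_of_ge hfloor (by
    calc _ ≤ x / g * g := by gcongr; exact Int.floor_le _
      _ = x := hxx)
  have h3 : (⌈x / g⌉ : ℝ) * g ≤ x + g := by
    have := mul_le_mul_of_nonneg_right (Int.ceil_lt_add_one (x / g)).le hg0.le
    rw [add_mul, hxx] at this; linarith
  have h4 : x - g ≤ (⌊x / g⌋ : ℝ) * g := by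
    have := mul_le_mul_of_nonneg_right (Int.sub_one_lt_floor (x / g)).le hg0.le
    rw [sub_mul, hxx] at this; linarith
  rw [abs_le]; constructor <;> linarith

end IsRounding

end Rounding

/-! ## The permutation score -/

/-- A nontrivial permutation of `1, …, 5` has a smaller inner product with the identity. -/
theorem sum_mul_perm_le (σ : Equiv.Perm (Fin 5)) (hσ : σ ≠ 1) :
    ∑ a : Fin 5, ((a : ℤ) + 1) * ((σ a : ℤ) + 1) ≤ 54 := by
  have h1 : ∑ a : Fin 5, ((σ a : ℤ) + 1) ^ 2 = 55 := by
    rw [Equiv.sum_comp σ fun a : Fin 5 => ((a : ℤ) + 1) ^ 2]; decide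
  have h2 : ∑ a : Fin 5, ((a : ℤ) + 1) ^ 2 = 55 := by decide
  have h3 : 0 < ∑ a : Fin 5, ((a : ℤ) - σ a) ^ 2 := by
    obtain ⟨a, ha⟩ : ∃ a, σ a ≠ a := by
      by_contra! h
      exact hσ (Equiv.ext h)
    refine Finset.sum_pos' (fun _ _ => sq_nonneg _) ⟨a, Finset.mem_univ a, ?_⟩
    have : (a : ℤ) - σ a ≠ 0 := fun h => ha (Fin.ext (by omega))
    positivity
  -- Polarization: a positive squared distance `110 - 2 * S` forces the inner product `S` below 55.
  have h4 : ∑ a : Fin 5, ((a : ℤ) - σ a) ^ 2 = ∑ a : Fin 5, ((a : ℤ) + 1) ^ 2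
      + ∑ a : Fin 5, ((σ a : ℤ) + 1) ^ 2 - 2 * ∑ a : Fin 5, ((a : ℤ) + 1) * ((σ a : ℤ) + 1) := by
    rw [Finset.mul_sum, ← Finset.sum_add_distrib, ← Finset.sum_sub_distrib]
    exact Finset.sum_congr rfl fun a _ => by ring
  omega

/-! ## The transformer -/

/-- The logarithmic scale of the construction. -/
def logScale (n : ℕ) : ℕ := Nat.log 2 n + 5

/-- The precision used for sequences of length at most `n`. -/
def precision (n : ℕ) : ℕ := Nat.log 2 n + 41

/-- Coordinates `0, …, 4` hold the direction of the reflection, coordinate `5` marks the start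
token, and coordinate `6` is constant. -/
def tokenEmb : Token → Fin 7 → ℝ
  | .start => ![0, 0, 0, 0, 0, 1, 1]
  | .swap s => fun c =>
      if (c : ℕ) = s.1.1 then 1 else if (c : ℕ) = s.1.2 then -1 else if c = 6 then 1 else 0

/-- The query vector.  Its inner product with the key `(1, …, 5)` of the start token, permuted by
`σ`, is at least `15 * logScale n` if `σ = 1`, and at most `-15 * logScale n` otherwise. -/
def queryVec (n : ℕ) (a : Fin 5) : ℤ := logScale n * (30 * (a + 1) - 109)

/-- The attention head that tracks the product of the swaps. -/
def swapHead (n : ℕ) : Head 7 5 where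
  Wq := Matrix.of fun a c => if c = 6 then (queryVec n a : ℝ) else 0
  Wk := Matrix.of fun a c => if c = 5 then (a : ℝ) + 1 else 0
  Wv := Matrix.of fun a c => if c = 5 then (if a = 0 then 1 else 0) else 0
  Ww := Matrix.of fun a c => if c = a.castLE (by norm_num) then 1 else 0
  u := 0
  b := precision n

/-- The one-layer transformer that decides whether at most `n` swaps compose to the identity.  The
first head does all the work. -/
noncomputable def swapTransformer (n : ℕ) : OneLayer Token 2 7 5 1 where
  emb := tokenEmb
  head := fun _ => swapHead n
  Wo := Matrix.of fun c q => if c = 0 then (if q = (0, 0) then 1 else 0) else 0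
  W₁ := Matrix.of fun _ c => if c = 0 then 1 else 0
  b₁ := fun _ => -(2 : ℝ) ^ (-3 : ℤ)
  W₂ := fun _ => 1
  b₂ := 0

/-! ### Size and representability of the parameters. -/

theorem isBigO_precision :
    (fun n : ℕ => (precision n : ℝ)) =O[Filter.atTop] fun n : ℕ => Real.log (n : ℝ) := by
  -- 43 = 2 + 41: the binary logarithm is at most `2 * Real.log n`, and `1 ≤ Real.log n` for `n ≥
  -- 3`.
  refine Asymptotics.IsBigO.of_bound 43 ?_
  filter_upwards [Filter.eventually_ge_atTop 3] with n hn
  have hn' : (3 : ℝ) ≤ n := by exact_mod_cast hn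
  have h1 : 1 ≤ Real.log n := by
    rw [Real.le_log_iff_exp_le (by linarith)]
    linarith [Real.exp_one_lt_d9]
  have h2 : (Nat.log 2 n : ℝ) ≤ Real.log n / Real.log 2 := by
    simpa [Real.logb] using Real.natLog_le_logb n 2
  have h3 : Real.log n / Real.log 2 ≤ 2 * Real.log n := by
    rw [div_le_iff₀ (by positivity)]
    nlinarith [Real.log_two_gt_d9]
  rw [Real.norm_of_nonneg (by positivity), Real.norm_of_nonneg (by linarith)]
  simp only [precision]
  push_cast
  linarith

theorem two_pow_precision (n : ℕ) : 2 ^ precision n = 2 ^ 41 * 2 ^ Nat.log 2 n := by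
  rw [precision, pow_add, mul_comm]

theorem logScale_mul_le (n : ℕ) : 1000 * logScale n < 2 ^ precision n := by
  rw [two_pow_precision, logScale]
  have : Nat.log 2 n < 2 ^ Nat.log 2 n := Nat.lt_two_pow_self
  omega

/-- This makes the sum of `n` rounding errors, even with factors in the hundreds, negligible. -/
theorem mul_le_two_pow_precision (n : ℕ) : 1000000000 * n < 2 ^ precision n := by
  have := Nat.lt_pow_succ_log_self (by norm_num : 1 < 2) n
  rw [two_pow_precision]
  rw [pow_succ] at this
  omega

theorem le_two_pow_logScale (n : ℕ) : n ≤ 2 ^ logScale n :=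
  (Nat.lt_pow_succ_log_self one_lt_two n).le.trans
    (Nat.pow_le_pow_right two_pos (by rw [logScale]; omega))

theorem thousand_lt_two_pow_precision (n : ℕ) : (1000 : ℤ) < 2 ^ precision n := by
  have h := two_pow_precision n
  have : 0 < 2 ^ Nat.log 2 n := by positivity
  have h' : 1000 < 2 ^ precision n := by omega
  exact_mod_cast h'

theorem intCast_mem_floats_of_le (n : ℕ) {m : ℤ} (hm : |m| ≤ 1000) :
    (m : ℝ) ∈ floats (precision n) :=
  intCast_mem_floats (hm.trans_lt (thousand_lt_two_pow_precision n))

theorem mul_logScale_mem_floats (n : ℕ) {m : ℤ} (hm : |m| ≤ 1000) :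
    (m : ℝ) * logScale n ∈ floats (precision n) := by
  have := intCast_mem_floats (p := precision n) (m := m * logScale n) (by
    have h : (1000 * logScale n : ℤ) < 2 ^ precision n := by
      exact_mod_cast logScale_mul_le n
    rw [abs_mul, Nat.abs_cast]
    exact (mul_le_mul_of_nonneg_right hm (Nat.cast_nonneg _)).trans_lt h)
  simpa using this

theorem queryVec_mem_floats (n : ℕ) (a : Fin 5) :
    (queryVec n a : ℝ) ∈ floats (precision n) := by
  have := mul_logScale_mem_floats n (m := 30 * (a + 1) - 109) (by
    have := a.2
    rw [abs_le]; constructor <;> omega)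
  rwa [queryVec, mul_comm, Int.cast_mul, Int.cast_natCast]

theorem one_le_precision (n : ℕ) : 1 ≤ precision n := by simp [precision]

theorem key_mem_floats (n : ℕ) (a : Fin 5) : (a : ℝ) + 1 ∈ floats (precision n) := by
  have := intCast_mem_floats_of_le n (m := a + 1) (by have := a.2; rw [abs_le]; constructor <;> omega)
  simpa using this

theorem zpow_mem_floats_of_le (n : ℕ) {e : ℤ} (he : |e| ≤ 1000) :
    (2 : ℝ) ^ e ∈ floats (precision n) :=
  zpow_mem_floats (one_le_precision n)
    (he.trans_lt (thousand_lt_two_pow_precision n))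

theorem swapHead_representable (n : ℕ) : (swapHead n).Representable (precision n) := by
  have h0 := zero_mem_floats (p := precision n)
  have h1 := one_mem_floats (one_le_precision n)
  refine ⟨fun a c => ?_, fun a c => ?_, fun a c => ?_, fun a c => ?_, fun c => h0, ?_⟩
  · simp only [swapHead, Matrix.of_apply]
    split_ifs
    exacts [queryVec_mem_floats n a, h0]
  · simp only [swapHead, Matrix.of_apply]
    split_ifs
    exacts [key_mem_floats n a, h0]
  · simp only [swapHead, Matrix.of_apply]
    split_ifs <;> assumption
  · simp only [swapHead, Matrix.of_apply]
    split_ifs <;> assumption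
  · have := intCast_mem_floats (p := precision n) (m := precision n) (by
      rw [abs_of_nonneg (by positivity)]; exact_mod_cast Nat.lt_two_pow_self)
    rwa [Int.cast_natCast] at this

theorem tokenEmb_mem_floats (n : ℕ) (v : Token) (c : Fin 7) :
    tokenEmb v c ∈ floats (precision n) := by
  have h0 := zero_mem_floats (p := precision n)
  have h1 := one_mem_floats (one_le_precision n)
  cases v with
  | start => fin_cases c <;> simpa [tokenEmb]
  | swap s =>
    simp only [tokenEmb]
    split_ifs
    exacts [h1, neg_mem_floats h1, h1, h0]

theorem swapTransformer_representable (n : ℕ) :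
    (swapTransformer n).Representable (precision n) := by
  have h0 := zero_mem_floats (p := precision n)
  have h1 := one_mem_floats (one_le_precision n)
  refine ⟨tokenEmb_mem_floats n, fun _ => swapHead_representable n, fun c q => ?_, fun l c => ?_,
    fun l => ?_, fun l => h1, h0⟩
  · simp only [swapTransformer, Matrix.of_apply]
    split_ifs <;> assumption
  · simp only [swapTransformer, Matrix.of_apply]
    split_ifs <;> assumption
  · exact neg_mem_floats (zpow_mem_floats_of_le n (by norm_num))

/-! ## The computation of the head on single tokens -/

section Tokens

variable {n : ℕ} {r : ℝ → ℝ}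

theorem tokenEmb_last (v : Token) : tokenEmb v 6 = 1 := by
  cases v with
  | start => rfl
  | swap s =>
    have := s.1.1.2
    have := s.1.2.2
    simp only [tokenEmb]
    rw [if_neg, if_neg] <;> simp <;> omega

theorem tokenEmb_swap_five (s : Swap) : tokenEmb (.swap s) 5 = 0 := by
  have := s.1.1.2
  have := s.1.2.2
  simp only [tokenEmb]
  rw [if_neg, if_neg, if_neg (by decide)] <;>
    simp only [Fin.isValue, Fin.coe_ofNat_eq_mod] <;> omega

/-- The query reads only the constant coordinate 6, so it does not matter which token comes last,
including `#` when there are no swaps. -/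
theorem swapHead_query (hr : IsRounding (precision n) r) (v : Token) (a : Fin 5) :
    (swapHead n).query r (tokenEmb v) a = queryVec n a := by
  simp [Head.query, roundVec, swapHead, Matrix.mulVec, dotProduct, tokenEmb_last,
    hr.exact _ (queryVec_mem_floats n a)]

theorem swapHead_key_start (hr : IsRounding (precision n) r) (a : Fin 5) :
    (swapHead n).key r (tokenEmb .start) a = (a : ℝ) + 1 := by
  have : tokenEmb .start 5 = 1 := rfl
  simp [Head.key, roundVec, swapHead, Matrix.mulVec, dotProduct, this,
    hr.exact _ (key_mem_floats n a)]

theorem swapHead_key_swap (hr : IsRounding (precision n) r) (s : Swap) :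
    (swapHead n).key r (tokenEmb (.swap s)) = 0 := by
  funext a
  simp [Head.key, roundVec, swapHead, Matrix.mulVec, dotProduct, tokenEmb_swap_five, hr.map_zero]

theorem swapHead_value_start (hr : IsRounding (precision n) r) :
    (swapHead n).value r (tokenEmb .start) 0 = 1 := by
  have : tokenEmb .start 5 = 1 := rfl
  simp [Head.value, roundVec, swapHead, Matrix.mulVec, dotProduct, this,
    hr.map_one (one_le_precision n)]

theorem swapHead_value_swap (hr : IsRounding (precision n) r) (s : Swap) :
    (swapHead n).value r (tokenEmb (.swap s)) 0 = 0 := by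
  simp [Head.value, roundVec, swapHead, Matrix.mulVec, dotProduct, tokenEmb_swap_five, hr.map_zero]

theorem swapHead_preDir_swap (hr : IsRounding (precision n) r) (s : Swap) (a : Fin 5) :
    (swapHead n).preDir r (tokenEmb (.swap s)) a =
      if a = s.1.1 then 1 else if a = s.1.2 then -1 else 0 := by
  have h1 := hr.map_one (one_le_precision n)
  have h1' := hr.exact _ (neg_mem_floats (one_mem_floats (one_le_precision n)))
  have h6 : Fin.castLE (by norm_num : 5 ≤ 7) a ≠ 6 := by
    have := a.2
    simp [Fin.ext_iff]; omega
  simp only [Head.preDir, roundVec, swapHead, Matrix.mulVec, dotProduct, Matrix.of_apply, ite_mul,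
    one_mul, zero_mul, Finset.sum_ite_eq', Finset.mem_univ, if_true, tokenEmb,
    Fin.val_castLE, h6, if_false, ← Fin.ext_iff]
  split_ifs
  exacts [h1, h1', hr.map_zero]

theorem swapHead_preDir_dotProduct (hr : IsRounding (precision n) r) (s : Swap) :
    (swapHead n).preDir r (tokenEmb (.swap s)) ⬝ᵥ (swapHead n).preDir r (tokenEmb (.swap s)) = 2 := by
  have h : ∀ a, (swapHead n).preDir r (tokenEmb (.swap s)) a *
      (swapHead n).preDir r (tokenEmb (.swap s)) a =
        (if a = s.1.1 then 1 else 0) + (if a = s.1.2 then 1 else 0) := fun a => by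
    rw [swapHead_preDir_swap hr]
    have := s.2
    by_cases h1 : a = s.1.1 <;> by_cases h2 : a = s.1.2 <;> simp_all
  simp only [dotProduct, h, Finset.sum_add_distrib, Finset.sum_ite_eq', Finset.mem_univ, if_true]
  norm_num

end Tokens

/-! ## Error analysis -/

section Error

variable {n : ℕ} {r : ℝ → ℝ}

/-- The bound for the absolute rounding errors. -/
noncomputable def roundErr (n : ℕ) : ℝ := 8 / 2 ^ precision n

theorem roundErr_pos (n : ℕ) : 0 < roundErr n := by
  unfold roundErr; positivity

theorem mul_roundErr_le (n : ℕ) : n * roundErr n ≤ 1 / 10 ^ 8 := by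
  have h : (1000000000 * n : ℝ) < 2 ^ precision n := by
    exact_mod_cast mul_le_two_pow_precision n
  rw [roundErr, mul_div_assoc', div_le_iff₀ (by positivity)]
  linarith

theorem roundErr_le (n : ℕ) : roundErr n ≤ 1 / 100 := by
  have h : (1000 : ℝ) < 2 ^ precision n := by
    exact_mod_cast thousand_lt_two_pow_precision n
  rw [roundErr, div_le_iff₀ (by positivity)]
  linarith

theorem IsRounding.abs_sub_le_roundErr (hr : IsRounding (precision n) r) {x : ℝ} (hx : |x| ≤ 7) :
    |r x - x| ≤ roundErr n := hr.abs_sub_le (by simp [precision]) hx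

theorem one_sub_sigmoid_natCast_le (m : ℕ) : 1 - Real.sigmoid m ≤ 1 / 2 ^ m := by
  have h1 : (2 : ℝ) ^ m ≤ Real.exp m := by
    rw [← mul_one (m : ℝ), Real.exp_nat_mul]
    gcongr
    linarith [Real.exp_one_gt_d9]
  have h2 : 1 - Real.sigmoid m = 1 / (1 + Real.exp m) := by
    rw [Real.sigmoid_def, Real.exp_neg]
    field_simp
    ring
  rw [h2]
  gcongr
  linarith

/-- The sigmoid never reaches 1, but the bias `precision n` brings it within `2 ^ (-precision n)`,
which is below the rounding error. -/
theorem swapHead_beta (hr : IsRounding (precision n) r) (x : Fin 7 → ℝ) :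
    |(swapHead n).beta r x - 2| ≤ 2 * roundErr n := by
  have hp : r (precision n) = precision n := hr.exact _ (swapHead_representable n).2.2.2.2.2
  have h : (swapHead n).beta r x = r (2 * Real.sigmoid (precision n)) := by
    simp [Head.beta, swapHead, hp]
  have h0 := Real.sigmoid_nonneg (precision n : ℝ)
  have h1 := Real.sigmoid_le_one (precision n : ℝ)
  have h2 := one_sub_sigmoid_natCast_le (precision n)
  have h3 := hr.abs_sub_le_roundErr (x := 2 * Real.sigmoid (precision n)) (by
    rw [abs_le]; constructor <;> linarith)
  have h4 : 1 / 2 ^ precision n = roundErr n / 8 := by rw [roundErr]; field_simp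
  have := roundErr_pos n
  rw [abs_le] at h3 ⊢
  rw [h]
  constructor <;> linarith

/-- The direction `e_a - e_b` of a swap. -/
def Swap.direction (s : Swap) (a : Fin 5) : ℝ :=
  if a = s.1.1 then 1 else if a = s.1.2 then -1 else 0

theorem Swap.abs_direction_le (s : Swap) (a : Fin 5) : |s.direction a| ≤ 1 := by
  unfold Swap.direction; split_ifs <;> simp

theorem Swap.one_sub_direction (s : Swap) (a c : Fin 5) :
    (1 : Matrix (Fin 5) (Fin 5) ℝ) a c - s.direction a * s.direction c =
      if a = s.perm c then 1 else 0 := by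
  obtain ⟨⟨x, y⟩, hxy⟩ := s
  simp only [Swap.direction, Swap.perm, Matrix.one_apply, Equiv.swap_apply_def]
  simp only [ne_eq] at hxy
  have hyx : ¬y = x := fun h => hxy h.symm
  by_cases h1 : a = x <;> by_cases h2 : a = y <;> by_cases h3 : c = x <;> by_cases h4 : c = y <;>
    by_cases h5 : a = c <;> simp_all

theorem swapHead_dir (hr : IsRounding (precision n) r) (s : Swap) (a : Fin 5) :
    |(swapHead n).dir r (tokenEmb (.swap s)) a - s.direction a / √2| ≤ roundErr n := by
  rw [Head.dir, roundVec, swapHead_preDir_dotProduct hr, swapHead_preDir_swap hr]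
  refine hr.abs_sub_le_roundErr ?_
  have h2 : (1 : ℝ) ≤ √2 := Real.one_le_sqrt.2 (by norm_num)
  have h := s.abs_direction_le a
  change |s.direction a / √2| ≤ 7
  rw [abs_div, abs_of_pos (by positivity : 0 < √2), div_le_iff₀ (by positivity)]
  linarith

/-- Perturbation of a rank one update with coefficient `2`. -/
theorem abs_mul_mul_sub_le {β w w' z z' ε : ℝ} (hε : ε ≤ 1 / 2) (hβ : |β - 2| ≤ 2 * ε)
    (hw : |w - z| ≤ ε) (hw' : |w' - z'| ≤ ε) (hz : |z| ≤ 1) (hz' : |z'| ≤ 1) :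
    |β * w * w' - 2 * z * z'| ≤ 14 * ε := by
  have hε0 : 0 ≤ ε := (abs_nonneg _).trans hw
  have h1 : |w| ≤ 2 := by
    have := abs_add_le (w - z) z
    rw [sub_add_cancel] at this; linarith
  have h2 : |w'| ≤ 2 := by
    have := abs_add_le (w' - z') z'
    rw [sub_add_cancel] at this; linarith
  have h3 : β * w * w' - 2 * z * z' = (β - 2) * (w * w') + 2 * ((w - z) * w' + z * (w' - z')) := by
    ring
  rw [h3]
  -- The three error terms add up to `8 ε + 2 (2 ε + ε) = 14 ε`.
  have h4 : |(β - 2) * (w * w')| ≤ 2 * ε * (2 * 2) := by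
    rw [abs_mul, abs_mul]; gcongr
  have h5 : |(w - z) * w'| ≤ ε * 2 := by rw [abs_mul]; gcongr
  have h6 : |z * (w' - z')| ≤ 1 * ε := by rw [abs_mul]; gcongr
  have h7 := abs_add_le ((β - 2) * (w * w')) (2 * ((w - z) * w' + z * (w' - z')))
  have h8 := abs_add_le ((w - z) * w') (z * (w' - z'))
  rw [abs_mul 2, abs_of_pos (by norm_num : (0 : ℝ) < 2)] at h7
  linarith

/-- The exact reflection in `(e_x - e_y) / √2` is the permutation matrix of the swap. The error of
the rank one term is at most 14 units, and rounding the entry adds one. -/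
theorem swapHead_transition (hr : IsRounding (precision n) r) (s : Swap) (a c : Fin 5) :
    |(swapHead n).transition r (tokenEmb (.swap s)) a c - if a = s.perm c then 1 else 0| ≤
      15 * roundErr n := by
  have hε := roundErr_le n
  have hz : ∀ a, |s.direction a / √2| ≤ 1 := fun a => by
    have h2 : (1 : ℝ) ≤ √2 := Real.one_le_sqrt.2 (by norm_num)
    have h := s.abs_direction_le a
    rw [abs_div, abs_of_pos (by positivity : 0 < √2), div_le_iff₀ (by positivity)]
    linarith
  have h1 := abs_mul_mul_sub_le (by linarith) (swapHead_beta hr (tokenEmb (.swap s)))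
    (swapHead_dir hr s a) (swapHead_dir hr s c) (hz a) (hz c)
  have h2 : 2 * (s.direction a / √2) * (s.direction c / √2) = s.direction a * s.direction c := by
    have : √2 * √2 = (2 : ℝ) := Real.mul_self_sqrt (by norm_num)
    field_simp
    rw [sq, this]; ring
  rw [h2] at h1
  have h3 := s.one_sub_direction a c
  have h4 : |(if a = s.perm c then 1 else 0 : ℝ)| ≤ 1 := by split_ifs <;> simp
  rw [Head.transition, Matrix.of_apply]
  have hε0 := roundErr_pos n
  have h5 := hr.abs_sub_le_roundErr (x := (1 : Matrix (Fin 5) (Fin 5) ℝ) a c -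
    (swapHead n).beta r (tokenEmb (.swap s)) * (swapHead n).dir r (tokenEmb (.swap s)) a *
      (swapHead n).dir r (tokenEmb (.swap s)) c) (by
    rw [abs_le] at h1 h4 ⊢
    constructor <;> linarith)
  rw [abs_le] at h1 h4 h5 ⊢
  constructor <;> linarith

/-- One step of the propagation of the key. -/
theorem abs_vecMul_transition_sub_le (hr : IsRounding (precision n) r) (s : Swap)
    {v : Fin 5 → ℝ} (z : Fin 5 → ℝ) {ε : ℝ} (hε : ε + 450 * roundErr n ≤ 1)
    (hz : ∀ a, |z a| ≤ 5) (hv : ∀ a, |v a - z a| ≤ ε) (a : Fin 5) :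
    |roundVec r (Matrix.vecMul v ((swapHead n).transition r (tokenEmb (.swap s)))) a - z (s.perm a)|
      ≤ ε + 451 * roundErr n := by
  have hε0 := roundErr_pos n
  have hv6 : ∀ a, |v a| ≤ 6 := fun a => by
    have := abs_add_le (v a - z a) (z a)
    rw [sub_add_cancel] at this
    linarith [hv a, hz a]
  set H := (swapHead n).transition r (tokenEmb (.swap s)) with hH
  have h1 : Matrix.vecMul v H a - v (s.perm a) =
      ∑ b, v b * (H b a - if b = s.perm a then 1 else 0) := by
    simp [Matrix.vecMul, dotProduct, mul_sub, Finset.sum_sub_distrib]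
  -- 450 = 5 · 6 · 15: five summands, entries of `v` at most 6, matrix error 15. The old error `ε`
  -- is only permuted, so errors accumulate additively.
  have h2 : |Matrix.vecMul v H a - v (s.perm a)| ≤ 450 * roundErr n := by
    rw [h1]
    refine (Finset.abs_sum_le_sum_abs _ _).trans ?_
    calc _ ≤ ∑ _b : Fin 5, 6 * (15 * roundErr n) := by
          refine Finset.sum_le_sum fun b _ => ?_
          rw [abs_mul]
          exact mul_le_mul (hv6 b) (swapHead_transition hr s b a) (abs_nonneg _) (by norm_num)
      _ = 450 * roundErr n := by simp; ring
  have h3 := hv (s.perm a)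
  have h4 := hz (s.perm a)
  have h5 := hr.abs_sub_le_roundErr (x := Matrix.vecMul v H a) (by
    rw [abs_le] at *; constructor <;> linarith)
  rw [roundVec]
  rw [abs_le] at *
  constructor <;> linarith

end Error

/-! ## The attention pattern -/

section Attention

variable {n : ℕ} {r : ℝ → ℝ}

theorem embed_tokens_zero (w : List Swap) :
    (swapTransformer n).embed (tokens w) 0 = tokenEmb .start := rfl

theorem embed_tokens_succ (w : List Swap) {t : ℕ} (ht : t < w.length) :
    (swapTransformer n).embed (tokens w) (t + 1) = tokenEmb (.swap w[t]) := by
  simp [OneLayer.embed, tokens, swapTransformer, ht]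

theorem exists_embed_tokens (w : List Swap) {t : ℕ} (ht : t ≤ w.length) :
    ∃ v, (swapTransformer n).embed (tokens w) t = tokenEmb v := by
  cases t with
  | zero => exact ⟨_, embed_tokens_zero w⟩
  | succ t => exact ⟨_, embed_tokens_succ w ht⟩

/-- The key of the start token is permuted by the swaps. -/
theorem abs_carry_start_sub_le (hr : IsRounding (precision n) r) (w : List Swap)
    (hw : w.length ≤ n) (t : ℕ) (ht : t ≤ w.length) (a : Fin 5) :
    |(swapHead n).carry r ((swapTransformer n).embed (tokens w)) 0 t a -
      (((((w.take t).map Swap.perm).prod a : Fin 5) : ℝ) + 1)| ≤ t * (451 * roundErr n) := by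
  induction t generalizing a with
  | zero => simp [Head.carry, embed_tokens_zero, swapHead_key_start hr]
  | succ t ih =>
    have hn : ((t + 1 : ℕ) : ℝ) ≤ n := by exact_mod_cast ht.trans hw
    have hε0 := roundErr_pos n
    have hε := mul_roundErr_le n
    have hε' : ((t + 1 : ℕ) : ℝ) * roundErr n ≤ 1 / 10 ^ 8 :=
      (mul_le_mul_of_nonneg_right hn hε0.le).trans hε
    push_cast at hε'
    have key := abs_vecMul_transition_sub_le hr w[t]
      (fun a => ((((w.take t).map Swap.perm).prod a : Fin 5) : ℝ) + 1) (by linarith)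
      (fun a => by
        have : (((w.take t).map Swap.perm).prod a : ℕ) + 1 ≤ 5 := Fin.is_lt _
        rw [abs_of_nonneg (by positivity)]
        exact_mod_cast this)
      (fun a => ih (by omega) a) a
    rw [Head.carry, zero_add, embed_tokens_succ w ht, List.take_succ_eq_append_getElem ht,
      List.map_append, List.prod_append, Equiv.Perm.mul_apply]
    simp only [List.map_cons, List.map_nil, List.prod_cons, List.prod_nil, mul_one]
    refine key.trans_eq ?_
    push_cast
    ring

/-- Keys of swap tokens are exactly zero, and zero survives every product and rounding; hence these
positions have score exactly 1. -/
theorem carry_swap (hr : IsRounding (precision n) r) (w : List Swap) {j : ℕ} (hj : j < w.length)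
    (t : ℕ) : (swapHead n).carry r ((swapTransformer n).embed (tokens w)) (j + 1) t = 0 := by
  induction t with
  | zero => rw [Head.carry, embed_tokens_succ w hj, swapHead_key_swap hr]
  | succ t ih =>
    rw [Head.carry, ih, Matrix.zero_vecMul]
    exact funext fun _ => hr.map_zero

theorem score_swap (hr : IsRounding (precision n) r) (w : List Swap) {j : ℕ} (hj : j < w.length)
    (i : ℕ) : (swapHead n).score r ((swapTransformer n).embed (tokens w)) i (j + 1) = 1 := by
  rw [Head.score, Head.logit, carry_swap hr w hj, zero_dotProduct, hr.map_zero, Real.exp_zero,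
    hr.map_one (one_le_precision n)]

/-- The exact value of the logit at the start token, for the permutation `σ`. -/
def startLogit (n : ℕ) (σ : Equiv.Perm (Fin 5)) : ℤ :=
  ∑ a, ((σ a : ℤ) + 1) * queryVec n a

theorem startLogit_eq (n : ℕ) (σ : Equiv.Perm (Fin 5)) :
    startLogit n σ =
      logScale n * (30 * ∑ a : Fin 5, ((a : ℤ) + 1) * ((σ a : ℤ) + 1) - 1635) := by
  have h1 : ∑ a : Fin 5, ((σ a : ℤ) + 1) = 15 := by
    rw [Equiv.sum_comp σ fun a : Fin 5 => ((a : ℤ) + 1)]; decide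
  -- 1635 = 30 · 54.5 puts the zero of the logit midway between the inner products 54 and 55; the
  -- constant can be put into the query because the entries `σ a + 1` always sum to 15.
  have h2 : (1635 : ℤ) = 109 * ∑ a : Fin 5, ((σ a : ℤ) + 1) := by rw [h1]; norm_num
  rw [h2, startLogit, Finset.mul_sum, Finset.mul_sum, ← Finset.sum_sub_distrib, Finset.mul_sum]
  refine Finset.sum_congr rfl fun a _ => ?_
  rw [queryVec]; ring

theorem startLogit_one (n : ℕ) : startLogit n 1 = logScale n * 15 := by
  have h : ∑ a : Fin 5, ((a : ℤ) + 1) * (((1 : Equiv.Perm (Fin 5)) a : ℤ) + 1) = 55 := by decide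
  rw [startLogit_eq, h]
  norm_num

theorem startLogit_le (n : ℕ) {σ : Equiv.Perm (Fin 5)} (hσ : σ ≠ 1) :
    startLogit n σ ≤ logScale n * -15 := by
  rw [startLogit_eq]
  have := sum_mul_perm_le σ hσ
  gcongr
  linarith

theorem sum_abs_queryVec (n : ℕ) : ∑ a, |(queryVec n a : ℝ)| = 199 * logScale n := by
  have h : ∑ a, |queryVec n a| = 199 * logScale n := by
    simp only [queryVec, abs_mul, Nat.abs_cast, ← Finset.mul_sum]
    have h : ∑ a : Fin 5, |(30 * ((a : ℤ) + 1) - 109)| = 199 := by decide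
    rw [h, mul_comm]
  exact_mod_cast h

/-- The product of the swaps. -/
def swapProd (w : List Swap) : Equiv.Perm (Fin 5) := (w.map Swap.perm).prod

theorem abs_dotProduct_start_sub_le (hr : IsRounding (precision n) r) (w : List Swap)
    (hw : w.length ≤ n) (v : Token) :
    |(swapHead n).carry r ((swapTransformer n).embed (tokens w)) 0 w.length ⬝ᵥ
      (swapHead n).query r (tokenEmb v) - startLogit n (swapProd w)| ≤ logScale n := by
  have hε0 := roundErr_pos n
  -- The query has `ℓ¹` norm `199 * logScale n`, so this accuracy of the key gives a logit error of
  -- at most `logScale n`.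
  have hε : (w.length : ℝ) * (451 * roundErr n) ≤ 1 / 199 := by
    have h1 := mul_roundErr_le n
    have h2 : (w.length : ℝ) * roundErr n ≤ n * roundErr n := by gcongr
    linarith
  have h : (swapHead n).carry r ((swapTransformer n).embed (tokens w)) 0 w.length ⬝ᵥ
      (swapHead n).query r (tokenEmb v) - startLogit n (swapProd w) =
      ∑ a, ((swapHead n).carry r ((swapTransformer n).embed (tokens w)) 0 w.length a -
        ((((w.take w.length).map Swap.perm).prod a : Fin 5) + 1)) * queryVec n a := by
    simp [dotProduct, startLogit, swapHead_query hr, swapProd, sub_mul, Finset.sum_sub_distrib]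
  rw [h]
  refine (Finset.abs_sum_le_sum_abs _ _).trans ?_
  calc _ ≤ ∑ a, 1 / 199 * |(queryVec n a : ℝ)| := by
        refine Finset.sum_le_sum fun a _ => ?_
        rw [abs_mul]
        gcongr
        exact (abs_carry_start_sub_le hr w hw w.length le_rfl a).trans hε
    _ = logScale n := by rw [← Finset.mul_sum, sum_abs_queryVec]; ring

theorem logit_start_mem_Icc (hr : IsRounding (precision n) r) (w : List Swap)
    (hw : w.length ≤ n) (h : swapProd w = 1) :
    (swapHead n).logit r ((swapTransformer n).embed (tokens w)) w.length 0 ∈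
      Set.Icc (14 * logScale n : ℝ) (16 * logScale n) := by
  obtain ⟨v, hv⟩ := exists_embed_tokens (n := n) w le_rfl
  have key := abs_dotProduct_start_sub_le hr w hw v
  rw [h, startLogit_one, abs_le] at key
  push_cast at key
  rw [Head.logit, hv, Nat.sub_zero]
  constructor
  · exact hr.ge_of_ge (by simpa using mul_logScale_mem_floats n (m := 14) (by norm_num))
      (by linarith)
  · exact hr.le_of_le (by simpa using mul_logScale_mem_floats n (m := 16) (by norm_num))
      (by linarith)

theorem logit_start_le (hr : IsRounding (precision n) r) (w : List Swap)
    (hw : w.length ≤ n) (h : swapProd w ≠ 1) :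
    (swapHead n).logit r ((swapTransformer n).embed (tokens w)) w.length 0 ≤ -14 * logScale n := by
  obtain ⟨v, hv⟩ := exists_embed_tokens (n := n) w le_rfl
  have key := abs_dotProduct_start_sub_le hr w hw v
  have h' : (startLogit n (swapProd w) : ℝ) ≤ logScale n * -15 := by
    exact_mod_cast startLogit_le n h
  rw [abs_le] at key
  rw [Head.logit, hv, Nat.sub_zero]
  exact hr.le_of_le (by simpa using mul_logScale_mem_floats n (m := -14) (by norm_num))
    (by linarith)

/-! ### From logits to attention weights. -/

theorem normalizer_eq (hr : IsRounding (precision n) r) (w : List Swap) :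
    (swapHead n).normalizer r ((swapTransformer n).embed (tokens w)) w.length =
      r (w.length + (swapHead n).score r ((swapTransformer n).embed (tokens w)) w.length 0) := by
  rw [Head.normalizer, Finset.sum_range_succ']
  congr 2
  rw [Finset.sum_congr rfl fun j hj => score_swap hr w (Finset.mem_range.1 hj) _]
  simp

/-- Scores may be as large as `exp (16 * logScale n)`; the exponent range must contain powers of two
of this size, so that rounding does not saturate. -/
theorem two_zpow_mem_floats_of_le_logScale {e : ℤ} (he : |e| ≤ 1000 * logScale n) :
    (2 : ℝ) ^ e ∈ floats (precision n) :=
  zpow_mem_floats (one_le_precision n) (he.trans_lt (by exact_mod_cast logScale_mul_le n))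

theorem five_le_logScale (n : ℕ) : 5 ≤ logScale n := by simp [logScale]

theorem weight_start_ge (hr : IsRounding (precision n) r) (w : List Swap)
    (hw : w.length ≤ n) (h : swapProd w = 1) :
    1 / 4 ≤ (swapHead n).weight r ((swapTransformer n).embed (tokens w)) w.length 0 := by
  have h5 := five_le_logScale n
  obtain ⟨h1, h2⟩ := logit_start_mem_Icc hr w hw h
  have hlow : (2 : ℝ) ^ logScale n ≤
      (swapHead n).score r ((swapTransformer n).embed (tokens w)) w.length 0 := by
    rw [← zpow_natCast]
    refine hr.ge_of_ge (two_zpow_mem_floats_of_le_logScale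
      (by rw [Nat.abs_cast]; linarith [Nat.cast_nonneg (α := ℤ) (logScale n)])) ?_
    rw [zpow_natCast]
    calc (2 : ℝ) ^ logScale n ≤ Real.exp 1 ^ logScale n := by
          gcongr; linarith [Real.exp_one_gt_d9]
      _ = Real.exp (logScale n) := by rw [← Real.exp_nat_mul, mul_one]
      _ ≤ _ := by
          gcongr
          linarith [Nat.cast_nonneg (α := ℝ) (logScale n)]
  have hhigh : (swapHead n).score r ((swapTransformer n).embed (tokens w)) w.length 0 ≤
      2 ^ (2 * (16 * logScale n)) := by
    rw [← zpow_natCast]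
    refine hr.le_of_le (two_zpow_mem_floats_of_le_logScale
      (by rw [Nat.abs_cast]; push_cast; linarith [Nat.cast_nonneg (α := ℤ) (logScale n)])) ?_
    rw [zpow_natCast, pow_mul]
    calc _ ≤ Real.exp (16 * logScale n) := by gcongr
      _ = Real.exp 1 ^ (16 * logScale n) := by rw [← Real.exp_nat_mul, mul_one]; push_cast; rfl
      _ ≤ _ := by gcongr; linarith [Real.exp_one_lt_d9]
  rw [Head.weight, normalizer_eq hr]
  set x := (swapHead n).score r ((swapTransformer n).embed (tokens w)) w.length 0
  have hn : (n : ℝ) ≤ 2 ^ logScale n := by exact_mod_cast le_two_pow_logScale n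
  have hw' : (w.length : ℝ) ≤ n := by exact_mod_cast hw
  have hx : 0 < x := lt_of_lt_of_le (by positivity) hlow
  -- With `2 ^ k ≤ x < 2 ^ (k + 1)` and `w.length ≤ x`, the sum is below the representable number `2
  -- ^ (k + 2) ≤ 4 * x`, which therefore also bounds the rounded sum.
  obtain ⟨k, hk1, hk2⟩ := exists_nat_pow_near (x := x) (y := 2)
    (le_trans (one_le_pow₀ (by norm_num)) hlow) (by norm_num)
  have hk : k ≤ 2 * (16 * logScale n) :=
    (pow_le_pow_iff_right₀ (by norm_num : (1 : ℝ) < 2)).1 (hk1.trans hhigh)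
  have hZ : r (w.length + x) ≤ 4 * x := by
    have : r (w.length + x) ≤ 2 ^ ((k + 2 : ℕ) : ℤ) := by
      refine hr.le_of_le (two_zpow_mem_floats_of_le_logScale (by rw [Nat.abs_cast]; omega)) ?_
      rw [zpow_natCast]
      rw [pow_succ] at hk2 ⊢
      rw [pow_succ]
      linarith
    rw [zpow_natCast, pow_add] at this
    linarith
  have hZ0 : 1 ≤ r (w.length + x) := by
    refine hr.ge_of_ge (one_mem_floats (one_le_precision n)) ?_
    have : (1 : ℝ) ≤ 2 ^ logScale n := one_le_pow₀ (by norm_num)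
    linarith [Nat.cast_nonneg (α := ℝ) w.length]
  have h4 : (1 / 4 : ℝ) = 2 ^ (-2 : ℤ) := by norm_num
  rw [h4]
  refine hr.ge_of_ge (zpow_mem_floats_of_le n (by norm_num)) ?_
  rw [← h4, le_div_iff₀ (by linarith)]
  linarith

theorem weight_start_le (hr : IsRounding (precision n) r) (w : List Swap)
    (hw : w.length ≤ n) (h : swapProd w ≠ 1) :
    (swapHead n).weight r ((swapTransformer n).embed (tokens w)) w.length 0 ≤ 1 / 16 := by
  have h5 : (5 : ℝ) ≤ logScale n := by exact_mod_cast five_le_logScale n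
  have h1 := logit_start_le hr w hw h
  have h16 : (1 / 16 : ℝ) = 2 ^ (-4 : ℤ) := by norm_num
  have hmem : (1 / 16 : ℝ) ∈ floats (precision n) := by
    rw [h16]; exact zpow_mem_floats_of_le n (by norm_num)
  have hhigh : (swapHead n).score r ((swapTransformer n).embed (tokens w)) w.length 0 ≤ 1 / 16 := by
    refine hr.le_of_le hmem ?_
    calc _ ≤ Real.exp (-(4 : ℕ) * 1) := by gcongr; push_cast; linarith
      _ = (Real.exp 1 ^ 4)⁻¹ := by rw [neg_mul, Real.exp_neg, Real.exp_nat_mul]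
      _ ≤ (2 ^ 4)⁻¹ := by gcongr; linarith [Real.exp_one_gt_d9]
      _ = 1 / 16 := by norm_num
  have hlow : 0 ≤ (swapHead n).score r ((swapTransformer n).embed (tokens w)) w.length 0 :=
    hr.ge_of_ge zero_mem_floats (Real.exp_nonneg _)
  -- The empty sequence composes to the identity, so there is at least one swap, and its score 1
  -- bounds the normalizer from below.
  have hlen : (1 : ℝ) ≤ w.length := by
    have : w ≠ [] := by rintro rfl; exact h rfl
    exact_mod_cast List.length_pos_iff.2 this
  rw [Head.weight, normalizer_eq hr]
  have hZ : 1 ≤ r (w.length +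
      (swapHead n).score r ((swapTransformer n).embed (tokens w)) w.length 0) :=
    hr.ge_of_ge (one_mem_floats (one_le_precision n)) (by linarith)
  refine hr.le_of_le hmem ?_
  rw [div_le_iff₀ (by linarith)]
  linarith

/-! ### Readout by the values and the feed-forward layer. -/

theorem output_eq (hr : IsRounding (precision n) r) (w : List Swap) :
    (swapHead n).output r ((swapTransformer n).embed (tokens w)) w.length 0 =
      (swapHead n).weight r ((swapTransformer n).embed (tokens w)) w.length 0 := by
  rw [Head.output, Finset.sum_range_succ', Finset.sum_eq_zero, zero_add, embed_tokens_zero,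
    swapHead_value_start hr, mul_one]
  · exact hr.exact _ (hr.mem _)
  · intro j hj
    rw [embed_tokens_succ w (Finset.mem_range.1 hj), swapHead_value_swap hr, mul_zero]

theorem run_eq (hr : IsRounding (precision n) r) (w : List Swap) :
    (swapTransformer n).run r (tokens w) =
      r (Real.sign (r ((swapHead n).weight r ((swapTransformer n).embed (tokens w)) w.length 0 -
        1 / 8))) := by
  have hlen : (tokens w).length - 1 = w.length := by simp [tokens]
  have hatt : (swapTransformer n).attention r (tokens w) w.length 0 =
      (swapHead n).weight r ((swapTransformer n).embed (tokens w)) w.length 0 := by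
    rw [OneLayer.attention, roundVec, ← output_eq hr]
    have : ((swapTransformer n).Wo.mulVec fun q => ((swapTransformer n).head q.1).output r
        ((swapTransformer n).embed (tokens w)) w.length q.2) 0 =
        (swapHead n).output r ((swapTransformer n).embed (tokens w)) w.length 0 := by
      simp [swapTransformer, Matrix.mulVec, dotProduct]
    rw [this]
    exact hr.exact _ (hr.mem _)
  rw [OneLayer.run, hlen, OneLayer.ffn]
  generalize (swapTransformer n).attention r (tokens w) w.length = y at hatt
  rw [← hatt]
  simp [swapTransformer, Matrix.mulVec, dotProduct, sub_eq_add_neg]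
  norm_num

/-- The transformer decides whether the swaps compose to the identity. -/
theorem swapTransformer_run (hr : IsRounding (precision n) r) (w : List Swap)
    (hw : w.length ≤ n) :
    (w ∈ swapIdentity → (swapTransformer n).run r (tokens w) = 1) ∧
      (w ∉ swapIdentity → (swapTransformer n).run r (tokens w) = -1) := by
  have h1 := one_mem_floats (one_le_precision n)
  constructor <;> intro h <;> rw [run_eq hr]
  · have hge := weight_start_ge hr w hw h
    rw [Real.sign_of_pos, hr.exact _ h1]
    -- The argument of the sign is at least `1/4 - 1/8`, a representable positive number, so
    -- rounding cannot send it to 0. In the other case `1/16 - 1/8` plays this role.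
    refine lt_of_lt_of_le (by positivity : (0 : ℝ) < 2 ^ (-3 : ℤ)) (hr.ge_of_ge
      (zpow_mem_floats_of_le n (by norm_num)) ?_)
    norm_num at hge ⊢
    linarith
  · have hle := weight_start_le hr w hw h
    rw [Real.sign_of_neg, hr.exact _ (neg_mem_floats h1)]
    refine lt_of_le_of_lt (hr.le_of_le
      (neg_mem_floats (zpow_mem_floats_of_le n (e := -4) (by norm_num))) ?_)
      (by norm_num : -(2 : ℝ) ^ (-4 : ℤ) < 0)
    norm_num at hle ⊢
    linarith

end Attention

end PaTH

theorem theorem1 :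
    PaTH.NC1Complete PaTH.swapIdentity ∧
      ∃ (D d k : ℕ) (p : ℕ → ℕ),
        ((fun n : ℕ => (p n : ℝ)) =O[Filter.atTop] fun n : ℕ => Real.log (n : ℝ)) ∧
          ∀ n : ℕ, ∃ T : PaTH.OneLayer PaTH.Token 2 D d k,
            T.Representable (p n) ∧
              ∀ r : ℝ → ℝ, PaTH.IsRounding (p n) r →
                ∀ w : List PaTH.Swap, w.length ≤ n →
                  (w ∈ PaTH.swapIdentity → T.run r (PaTH.tokens w) = 1) ∧
                    (w ∉ PaTH.swapIdentity → T.run r (PaTH.tokens w) = -1) := by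
  refine ⟨PaTH.nc1Complete_swapIdentity, 7, 5, 1, PaTH.precision, PaTH.isBigO_precision, fun n =>
    ⟨PaTH.swapTransformer n, PaTH.swapTransformer_representable n, fun r hr w hw =>
      PaTH.swapTransformer_run hr w hw⟩⟩
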